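/- Let $\kappa$ be a weakly compact cardinal ($\kappa=\omega$ is allowed), i.e. $\kappa\ge\omega$ and $\kappa\to(\kappa)^2_2$. A partial order is a *$\kappa$-complete lattice* if all its subsets with fewer than $\kappa$ elements have a join and a meet. A $\kappa$-complete lattice $L$ is *$\kappa$-distributive* if the following holds for every family $(a_f)$ of elements of $L$ indexed by the nodes $f\in\kappa^{\beta}$, $\beta<\kappa$, of the tree $\kappa^{<\kappa}$: if * for every $\beta<\kappa$ and $f\in\kappa^{\beta}$ the set $\{a_g : g\in\kappa^{\beta+1},\ g|_\beta=f\}$ has fewer than $\kappa$ elements and $a_f\le\bigvee_{g\in\kappa^{\beta+1},\,g|_\beta=f}a_g$, and * $a_f=\bigwedge_{\alpha<\beta}a_{f|_\alpha}$ for every limit $\beta<\kappa$ and $f\in\kappa^\beta$, then, for every bar (an upward closed set of nodes that meets every branch $x\in\kappa^\kappa$), with set of minimal elements $B$, the join $\bigvee_{f\in B}\bigwedge_{\beta\le\delta_f}a_{f|_\beta}$ exists and is equal to $a_\emptyset$, where $\delta_f$ is the level of $f$. A *$\kappa$-Priestley space* is a topological space $X$ with a partial order such that: intersections of fewer than $\kappa$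 open sets are open; $X$ is Hausdorff; the clopen sets form a basis; every open cover has a subcover with fewer than $\kappa$ members; and whenever $x\not\le y$ there is a clopen upset containing $x$ but not $y$. Let $\mathbf{D}_\kappa$ be the category of $\kappa$-distributive lattices of cardinality at most $\kappa$, with the maps preserving joins and meets of fewer than $\kappa$ elements, and let $\mathbf{P}_\kappa$ be the category of $\kappa$-Priestley spaces of weight at most $\kappa$ (i.e. with a basis of at most $\kappa$ open sets), with the continuous monotone maps. Let $2=\{0<1\}$, regarded as a lattice and as a discrete ordered space. **Theorem.** Homming into $2$ gives a duality between $\mathbf{D}_\kappa$ and $\mathbf{P}_\kappa$. That is: 1. For $L$ in $\mathbf{D}_\kappa$ the set $\mathrm{Hom}(L,2)$ of maps $L\to2$ that preserve joins and meets of fewer than $\kappa$ elements, with pointwise order and the topology of pointwise convergence, is an object of $\mathbf{P}_\kappa$; for $X$ in $\mathbf{P}_\kappa$ the set $\mathrm{Hom}(X,2)$ of continuous monotone maps $X\to 2$ with pointwise order is an object of $\mathbf{D}_\kappa$. 2. With precomposition on morphisms, the functors $\mathrm{Hom}(-,2)\colon\mathbf{D}_\kappa^{\mathrm{op}}\to\mathbf{P}_\kappa$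 and $\mathrm{Hom}(-,2)\colon\mathbf{P}_\kappa\to\mathbf{D}_\kappa^{\mathrm{op}}$ are the two functors of an equivalence of categories $\mathbf{D}_\kappa^{\mathrm{op}}\simeq\mathbf{P}_\kappa$. 3. For every $L$ in $\mathbf{D}_\kappa$ the evaluation map $L\to\mathrm{Hom}(\mathrm{Hom}(L,2),2)$ is an order isomorphism, and for every $X$ in $\mathbf{P}_\kappa$ the evaluation map $X\to\mathrm{Hom}(\mathrm{Hom}(X,2),2)$ is an order isomorphism and a homeomorphism. -/

import Mathlib

open CategoryTheory Cardinal

universe u v w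

/-- Weakly compact cardinals, through the partition relation `κ → (κ)²₂`: every graph on `κ` many
vertices has a clique or an independent set of size `κ`. As usual in infinitary logic, `ℵ₀` is
allowed. -/
def IsWeaklyCompact (κ : Cardinal.{u}) : Prop :=
  ℵ₀ ≤ κ ∧ ∀ (V : Type u) (G : SimpleGraph V), #V = κ →
    ∃ H : Set V, #H = κ ∧ (G.IsClique H ∨ G.IsIndepSet H)

/-! ### κ-complete lattices -/

/-- A partial order in which all subsets with fewer than `κ` elements have a join and a meet
(for `κ` infinite this makes it a bounded lattice). -/
class KappaComplete (κ : Cardinal.{u}) (L : Type u) [PartialOrder L] : Prop where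
  exists_isLUB : ∀ s : Set L, #s < κ → ∃ a, IsLUB s a
  exists_isGLB : ∀ s : Set L, #s < κ → ∃ a, IsGLB s a

/-- Maps that preserve all joins and all meets of fewer than `κ` elements. -/
@[ext]
structure KappaHom (κ : Cardinal.{u}) (L : Type u) (M : Type v) [PartialOrder L]
    [PartialOrder M] where
  toFun : L → M
  map_isLUB : ∀ (s : Set L) (a : L), #s < κ → IsLUB s a → IsLUB (toFun '' s) (toFun a)
  map_isGLB : ∀ (s : Set L) (a : L), #s < κ → IsGLB s a → IsGLB (toFun '' s) (toFun a)

namespace KappaHom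

variable {κ : Cardinal.{u}}

instance {L : Type u} {M : Type v} [PartialOrder L] [PartialOrder M] :
    FunLike (KappaHom κ L M) L M where
  coe := toFun
  coe_injective f g h := by cases f; cases g; congr

/-- The identity. -/
def id (κ : Cardinal.{u}) (L : Type u) [PartialOrder L] : KappaHom κ L L where
  toFun := fun a => a
  map_isLUB s a _ h := by simpa using h
  map_isGLB s a _ h := by simpa using h

/-- Composition: `g` after `f`. -/
def comp {L M : Type u} {N : Type v} [PartialOrder L] [PartialOrder M] [PartialOrder N]
    (g : KappaHom κ M N) (f : KappaHom κ L M) : KappaHom κ L N where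
  toFun := fun a => g (f a)
  map_isLUB s a hs h := by
    have := g.map_isLUB _ _ (mk_image_le.trans_lt hs) (f.map_isLUB s a hs h)
    rwa [Set.image_image] at this
  map_isGLB s a hs h := by
    have := g.map_isGLB _ _ (mk_image_le.trans_lt hs) (f.map_isGLB s a hs h)
    rwa [Set.image_image] at this

/-- Homomorphisms are ordered pointwise. -/
instance {L : Type u} {M : Type v} [PartialOrder L] [PartialOrder M] :
    PartialOrder (KappaHom κ L M) :=
  PartialOrder.lift (fun f => (f : L → M)) DFunLike.coe_injective

/-- The homomorphisms `L → 2` carry the topology of pointwise convergence, i.e. the one generated by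
the sets `{h | h a = 1}` and `{h | h a = 0}` for `a` in `L`. (When `L` is `κ`-complete with `κ`
infinite, the sets `{h | h a = 1 ∧ h b = 0}` are a basis closed under intersections of fewer than
`κ` sets, so that this is also the `κ`-topology which has those sets as a subbasis.) -/
instance {L : Type u} [PartialOrder L] : TopologicalSpace (KappaHom κ L Bool) :=
  TopologicalSpace.induced (fun f => (f : L → Bool)) inferInstance

/-- Precomposition with a homomorphism, as a continuous monotone map between the hom-sets
into 2. -/
def precomp {L M : Type u} [PartialOrder L] [PartialOrder M] (f : KappaHom κ L M) :
    KappaHom κ M Bool →Co KappaHom κ L Bool where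
  toFun := fun h => h.comp f
  monotone' := fun _ _ h a => h (f a)
  continuous_toFun := by
    rw [continuous_induced_rng, continuous_pi_iff]
    intro a
    exact (continuous_apply (f a)).comp continuous_induced_dom

end KappaHom

/-- The category of `κ`-complete lattices: objects. -/
structure KappaLat (κ : Cardinal.{u}) : Type (u + 1) where
  carrier : Type u
  [partialOrder : PartialOrder carrier]
  [complete : KappaComplete κ carrier]

attribute [instance] KappaLat.partialOrder KappaLat.complete

instance (κ : Cardinal.{u}) : CoeSort (KappaLat κ) (Type u) := ⟨KappaLat.carrier⟩

/-- The category of `κ`-complete lattices: morphisms are the maps that preserve joins and meets of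
fewer than `κ` elements. -/
instance (κ : Cardinal.{u}) : Category (KappaLat κ) where
  Hom L M := KappaHom κ L M
  id L := KappaHom.id κ L
  comp f g := KappaHom.comp g f

/-! ### κ-distributive lattices -/

/-- The nodes `f ∈ κ^β`, `β < κ`, of the tree `κ^{<κ}`. The elements of `κ.ord.ToType` stand for the
ordinals below `κ`; `f.1` is the level `β` of the node. -/
abbrev KappaNode (κ : Cardinal.{u}) : Type u :=
  Σ β : κ.ord.ToType, (Set.Iio β → κ.ord.ToType)

/-- `f` is an initial segment of `g` (possibly `f = g`), i.e. `f = g|_β` for `β` the level of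
`f`. -/
def KappaNode.IsPrefix {κ : Cardinal.{u}} (f g : KappaNode κ) : Prop :=
  ∃ h : f.1 ≤ g.1, ∀ i : Set.Iio f.1, f.2 i = g.2 ⟨i.1, lt_of_lt_of_le i.2 h⟩

/-- The restriction to the level `β` of a branch `x ∈ κ^κ`. -/
def KappaNode.ofBranch {κ : Cardinal.{u}} (x : κ.ord.ToType → κ.ord.ToType)
    (β : κ.ord.ToType) : KappaNode κ :=
  ⟨β, fun i => x i.1⟩

/-- The immediate successors of a node `f ∈ κ^β`: the `g ∈ κ^{β+1}` with `g|_β = f`. -/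
def KappaNode.children {κ : Cardinal.{u}} (f : KappaNode κ) : Set (KappaNode κ) :=
  {g | f.1 ⋖ g.1 ∧ f.IsPrefix g}

/-- A bar: an upward closed set of nodes that meets every branch. -/
structure IsBar {κ : Cardinal.{u}} (U : Set (KappaNode κ)) : Prop where
  upward : ∀ f g : KappaNode κ, f ∈ U → f.IsPrefix g → g ∈ U
  meets : ∀ x : κ.ord.ToType → κ.ord.ToType, ∃ β, KappaNode.ofBranch x β ∈ U

/-- The minimal elements of a set of nodes. -/
def minimalNodes {κ : Cardinal.{u}} (U : Set (KappaNode κ)) : Set (KappaNode κ) :=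
  {f | f ∈ U ∧ ∀ g ∈ U, g.IsPrefix f → g = f}

/-- `κ`-distributivity. Let `a` be a family of elements indexed by the tree `κ^{<κ}` such that
* `a f ≤ ⋁ {a g | g an immediate successor of f}` for every node `f`, where the join is one of
  fewer than `κ` elements (elements may be repeated among the successors);
* `a f = ⋀ {a g | g a proper initial segment of f}` for every node `f` at a limit level.

Then for every bar `U`, with set of minimal elements `B`, the join over `f ∈ B` of the meets
`⋀ {a g | g an initial segment of f}` exists and is the element at the root. -/
def IsKappaDistributive (κ : Cardinal.{u}) (L : Type u) [PartialOrder L] : Prop :=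
  ∀ a : KappaNode κ → L,
    (∀ f : KappaNode κ, #(a '' f.children) < κ ∧
      ∃ j, IsLUB (a '' f.children) j ∧ a f ≤ j) →
    (∀ f : KappaNode κ, Order.IsSuccLimit f.1 →
      IsGLB (a '' {g | g.IsPrefix f ∧ g ≠ f}) (a f)) →
    ∀ U : Set (KappaNode κ), IsBar U →
      ∀ r : KappaNode κ, IsMin r.1 →
        IsLUB {m | ∃ f ∈ minimalNodes U, IsGLB (a '' {g | g.IsPrefix f}) m} (a r)

/-- The `κ`-distributive lattices of cardinality at most `κ`, among the `κ`-complete lattices. -/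
def isKappaDistLat (κ : Cardinal.{u}) : ObjectProperty (KappaLat κ) :=
  fun L => IsKappaDistributive κ L ∧ #L ≤ κ

/-- The category of `κ`-distributive lattices (of cardinality at most `κ`). -/
abbrev KappaDistLat (κ : Cardinal.{u}) : Type (u + 1) :=
  (isKappaDistLat κ).FullSubcategory

/-! ### κ-Priestley spaces -/

/-- Topological spaces with a partial order: objects. -/
structure OrdTop : Type (u + 1) where
  carrier : Type u
  [topologicalSpace : TopologicalSpace carrier]
  [partialOrder : PartialOrder carrier]

attribute [instance] OrdTop.topologicalSpace OrdTop.partialOrder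

instance : CoeSort OrdTop.{u} (Type u) := ⟨OrdTop.carrier⟩

/-- Topological spaces with a partial order: morphisms are the continuous monotone maps. -/
instance : Category OrdTop.{u} where
  Hom X Y := X →Co Y
  id X := ContinuousOrderHom.id X
  comp f g := ContinuousOrderHom.comp g f

/-- `κ`-spaces: intersections of fewer than `κ` open sets are open. -/
def IsKappaSpace (κ : Cardinal.{u}) (X : Type u) [TopologicalSpace X] : Prop :=
  ∀ S : Set (Set X), #S < κ → (∀ U ∈ S, IsOpen U) → IsOpen (⋂₀ S)

/-- `κ`-compactness: every open cover has a subcover with fewer than `κ` members. -/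
def IsKappaCompact (κ : Cardinal.{u}) (X : Type u) [TopologicalSpace X] : Prop :=
  ∀ S : Set (Set X), (∀ U ∈ S, IsOpen U) → ⋃₀ S = Set.univ →
    ∃ T ⊆ S, #T < κ ∧ ⋃₀ T = Set.univ

/-- `κ`-Stone spaces: `κ`-compact Hausdorff `κ`-spaces with a basis of clopen sets. -/
structure IsKappaStone (κ : Cardinal.{u}) (X : Type u) [TopologicalSpace X] : Prop where
  t2 : T2Space X
  kappaSpace : IsKappaSpace κ X
  clopenBasis : TopologicalSpace.IsTopologicalBasis {U : Set X | IsClopen U}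
  kappaCompact : IsKappaCompact κ X

/-- `κ`-Priestley spaces: `κ`-Stone spaces with a partial order that satisfies the Priestley
separation axiom (if `x ≰ y`, some clopen upset contains `x` but not `y`). -/
structure IsKappaPriestley (κ : Cardinal.{u}) (X : Type u) [TopologicalSpace X]
    [PartialOrder X] : Prop extends IsKappaStone κ X where
  priestley : PriestleySpace X

/-- The space has a basis of at most `κ` open sets. -/
def WeightLE (κ : Cardinal.{u}) (X : Type u) [TopologicalSpace X] : Prop :=
  ∃ B : Set (Set X), TopologicalSpace.IsTopologicalBasis B ∧ #B ≤ κ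

/-- The `κ`-Priestley spaces of weight at most `κ`, among the ordered topological spaces. -/
def isKappaPriestleySp (κ : Cardinal.{u}) : ObjectProperty OrdTop.{u} :=
  fun X => IsKappaPriestley κ X ∧ WeightLE κ X

/-- The category of `κ`-Priestley spaces (of weight at most `κ`), with the continuous monotone
maps. -/
abbrev KappaPriestley (κ : Cardinal.{u}) : Type (u + 1) :=
  (isKappaPriestleySp κ).FullSubcategory

/-! ### Homming into 2

The object `2` is `Bool`: as a lattice with `false < true`, as a space with the discrete topology and
the same order. -/

/-- `L ↦ Hom(L, 2)`, a space of `κ`-complete lattice homomorphisms (equivalently, of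
`κ`-complete, `κ`-prime filters), with pointwise topology and order; on morphisms,
precomposition. -/
def homTwoLat (κ : Cardinal.{u}) : (KappaLat κ)ᵒᵖ ⥤ OrdTop.{u} where
  obj L := ⟨KappaHom κ L.unop Bool⟩
  map f := KappaHom.precomp f.unop

section

variable {κ : Cardinal.{u}} {X : Type u} [TopologicalSpace X]

theorem Bool.isLUB_image_decide {ι : Type*} (s : Set ι) (g : ι → Bool) (b : Bool) :
    IsLUB (g '' s) b ↔ (b = true ↔ ∃ i ∈ s, g i = true) := by
  constructor
  · intro h
    constructor
    · rintro rfl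
      by_contra! hc
      have : (true : Bool) ≤ false := h.2 (by
        rintro _ ⟨i, hi, rfl⟩
        exact (Bool.eq_false_iff.2 (hc i hi)).le)
      exact absurd this (by decide)
    · rintro ⟨i, hi, hg⟩
      have := h.1 (Set.mem_image_of_mem g hi)
      rw [hg] at this
      exact top_le_iff.1 this
  · intro h
    refine ⟨?_, ?_⟩
    · rintro _ ⟨i, hi, rfl⟩
      cases hg : g i
      · exact bot_le
      · exact (h.2 ⟨i, hi, hg⟩).ge
    · intro c hc
      cases hb : b
      · exact bot_le
      · obtain ⟨i, hi, hg⟩ := h.1 hb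
        exact hg ▸ hc (Set.mem_image_of_mem g hi)

theorem Bool.isGLB_image_decide {ι : Type*} (s : Set ι) (g : ι → Bool) (b : Bool) :
    IsGLB (g '' s) b ↔ (b = true ↔ ∀ i ∈ s, g i = true) := by
  constructor
  · intro h
    constructor
    · rintro rfl i hi
      exact top_le_iff.1 (h.1 (Set.mem_image_of_mem g hi))
    · intro hc
      have : (true : Bool) ≤ b := h.2 (by
        rintro _ ⟨i, hi, rfl⟩
        exact (hc i hi).ge)
      exact top_le_iff.1 this
  · intro h
    refine ⟨?_, ?_⟩
    · rintro _ ⟨i, hi, rfl⟩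
      cases hb : b
      · exact bot_le
      · exact (h.1 hb i hi).ge
    · intro c hc
      cases c
      · exact bot_le
      · exact (h.2 fun i hi => top_le_iff.1 (hc (Set.mem_image_of_mem g hi))).ge

theorem IsKappaSpace.isOpen_biInter (h : IsKappaSpace κ X) {ι : Type u} (s : Set ι) (hs : #s < κ)
    (U : ι → Set X) (hU : ∀ i ∈ s, IsOpen (U i)) : IsOpen (⋂ i ∈ s, U i) := by
  rw [← Set.sInter_image]
  exact h _ (mk_image_le.trans_lt hs) (by rintro _ ⟨i, hi, rfl⟩; exact hU i hi)

theorem IsKappaSpace.isClopen_biInter (h : IsKappaSpace κ X) {ι : Type u} (s : Set ι)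
    (hs : #s < κ) (U : ι → Set X) (hU : ∀ i ∈ s, IsClopen (U i)) : IsClopen (⋂ i ∈ s, U i) :=
  ⟨isClosed_biInter fun i hi => (hU i hi).1, h.isOpen_biInter s hs U fun i hi => (hU i hi).2⟩

theorem IsKappaSpace.isClopen_biUnion (h : IsKappaSpace κ X) {ι : Type u} (s : Set ι)
    (hs : #s < κ) (U : ι → Set X) (hU : ∀ i ∈ s, IsClopen (U i)) : IsClopen (⋃ i ∈ s, U i) := by
  rw [← isClopen_compl_iff]
  simp only [Set.compl_iUnion]
  exact h.isClopen_biInter s hs _ fun i hi => (hU i hi).compl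

variable [PartialOrder X]

open Classical in
/-- The characteristic function of a clopen upset. -/
noncomputable def ContinuousOrderHom.ofClopen (U : Set X) (hU : IsClopen U) (hU' : IsUpperSet U) :
    X →Co Bool where
  toFun x := decide (x ∈ U)
  monotone' x y hxy := by
    by_cases hx : x ∈ U
    · simp [hx, hU' hxy hx]
    · simp [hx]
  continuous_toFun := by
    rw [continuous_bool_rng true]
    convert hU using 1
    ext x
    simp

theorem ContinuousOrderHom.ofClopen_apply (U : Set X) (hU : IsClopen U) (hU' : IsUpperSet U)
    (x : X) : ContinuousOrderHom.ofClopen U hU hU' x = true ↔ x ∈ U := by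
  classical
  exact decide_eq_true_iff

theorem ContinuousOrderHom.isClopen_preimage_true (g : X →Co Bool) : IsClopen {x | g x = true} :=
  (isClopen_discrete {true}).preimage (ContinuousOrderHomClass.toContinuousMapClass.map_continuous g)

/-- Joins of fewer than `κ` maps `X → 2` exist and are pointwise. -/
theorem IsKappaSpace.exists_join (h : IsKappaSpace κ X) (s : Set (X →Co Bool)) (hs : #s < κ) :
    ∃ a : X →Co Bool, IsLUB s a ∧ ∀ x, a x = true ↔ ∃ g ∈ s, g x = true := by
  let a := ContinuousOrderHom.ofClopen (⋃ g ∈ s, {x | g x = true})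
    (h.isClopen_biUnion s hs _ fun g _ => g.isClopen_preimage_true) (by
      intro x y hxy hx
      simp only [Set.mem_iUnion, Set.mem_ofPred_eq] at hx ⊢
      obtain ⟨g, hg, hgx⟩ := hx
      exact ⟨g, hg, top_le_iff.1 (hgx.ge.trans (g.monotone' hxy))⟩)
  have ha : ∀ x, a x = true ↔ ∃ g ∈ s, g x = true := fun x => by
    refine (ContinuousOrderHom.ofClopen_apply _ _ _ x).trans ?_
    simp
  refine ⟨a, ⟨fun g hg x => ?_, fun b hb x => ?_⟩, ha⟩
  · exact ((Bool.isLUB_image_decide s (fun g : X →Co Bool => g x) (a x)).2 (ha x)).1 ⟨g, hg, rfl⟩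
  · refine ((Bool.isLUB_image_decide s (fun g : X →Co Bool => g x) (a x)).2 (ha x)).2 ?_
    rintro _ ⟨g, hg, rfl⟩
    exact hb hg x

/-- Meets of fewer than `κ` maps `X → 2` exist and are pointwise. -/
theorem IsKappaSpace.exists_meet (h : IsKappaSpace κ X) (s : Set (X →Co Bool)) (hs : #s < κ) :
    ∃ a : X →Co Bool, IsGLB s a ∧ ∀ x, a x = true ↔ ∀ g ∈ s, g x = true := by
  let a := ContinuousOrderHom.ofClopen (⋂ g ∈ s, {x | g x = true})
    (h.isClopen_biInter s hs _ fun g _ => g.isClopen_preimage_true) (by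
      intro x y hxy hx
      simp only [Set.mem_iInter, Set.mem_ofPred_eq] at hx ⊢
      exact fun g hg => top_le_iff.1 ((hx g hg).ge.trans (g.monotone' hxy)))
  have ha : ∀ x, a x = true ↔ ∀ g ∈ s, g x = true := fun x => by
    refine (ContinuousOrderHom.ofClopen_apply _ _ _ x).trans ?_
    simp
  refine ⟨a, ⟨fun g hg x => ?_, fun b hb x => ?_⟩, ha⟩
  · exact ((Bool.isGLB_image_decide s (fun g : X →Co Bool => g x) (a x)).2 (ha x)).1 ⟨g, hg, rfl⟩
  · refine ((Bool.isGLB_image_decide s (fun g : X →Co Bool => g x) (a x)).2 (ha x)).2 ?_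
    rintro _ ⟨g, hg, rfl⟩
    exact hb hg x

theorem IsKappaSpace.kappaComplete (h : IsKappaSpace κ X) : KappaComplete κ (X →Co Bool) where
  exists_isLUB s hs := (h.exists_join s hs).imp fun _ ha => ha.1
  exists_isGLB s hs := (h.exists_meet s hs).imp fun _ ha => ha.1

/-- Precomposition with a continuous monotone map, as a `κ`-complete homomorphism between the
hom-sets into 2. -/
def ContinuousOrderHom.precompTwo {Y : Type u} [TopologicalSpace Y] [PartialOrder Y]
    (hX : IsKappaSpace κ X) (hY : IsKappaSpace κ Y) (f : X →Co Y) :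
    KappaHom κ (Y →Co Bool) (X →Co Bool) where
  toFun := fun g => g.comp f
  map_isLUB s a hs ha := by
    obtain ⟨a', ha', hp⟩ := hY.exists_join s hs
    obtain rfl := ha.unique ha'
    obtain ⟨b, hb, hq⟩ := hX.exists_join ((fun g : Y →Co Bool => g.comp f) '' s)
      (mk_image_le.trans_lt hs)
    convert hb using 1
    ext x
    rw [Bool.eq_iff_iff, hq x]
    simp [hp]
  map_isGLB s a hs ha := by
    obtain ⟨a', ha', hp⟩ := hY.exists_meet s hs
    obtain rfl := ha.unique ha'
    obtain ⟨b, hb, hq⟩ := hX.exists_meet ((fun g : Y →Co Bool => g.comp f) '' s)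
      (mk_image_le.trans_lt hs)
    convert hb using 1
    ext x
    rw [Bool.eq_iff_iff, hq x]
    simp [hp]

end

/-- `X ↦ Hom(X, 2)`, the `κ`-complete lattice of continuous monotone maps into `2` (equivalently, of
clopen upsets) with the pointwise order; on morphisms, precomposition. -/
def homTwoSpace (κ : Cardinal.{u}) : (KappaPriestley κ)ᵒᵖ ⥤ KappaLat κ where
  obj X :=
    { carrier := X.unop.obj →Co Bool
      complete := X.unop.property.1.kappaSpace.kappaComplete }
  map {X Y} f := ContinuousOrderHom.precompTwo Y.unop.property.1.kappaSpace
    X.unop.property.1.kappaSpace f.unop.hom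

/-- `L ↦ Hom(L, 2)` as a functor into `κ`-Priestley spaces, once its values are known to be such. -/
abbrev specFunctor (κ : Cardinal.{u})
    (hL : ∀ L : KappaDistLat κ, isKappaPriestleySp κ ((homTwoLat κ).obj (Opposite.op L.obj))) :
    (KappaDistLat κ)ᵒᵖ ⥤ KappaPriestley κ :=
  (isKappaPriestleySp κ).lift ((isKappaDistLat κ).ι.op ⋙ homTwoLat κ) fun L => hL L.unop

/-- `X ↦ Hom(X, 2)` as a functor into `κ`-distributive lattices, once its values are known to be
such. -/
abbrev clopenUpsetFunctor (κ : Cardinal.{u})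
    (hX : ∀ X : KappaPriestley κ, isKappaDistLat κ ((homTwoSpace κ).obj (Opposite.op X))) :
    (KappaPriestley κ)ᵒᵖ ⥤ KappaDistLat κ :=
  (isKappaDistLat κ).lift (homTwoSpace κ) fun X => hX X.unop

/-!
For a weakly compact `κ`, the duality rests on two existence results; the rest is the classical
argument for Priestley duality, with "finite" replaced by "fewer than `κ`".

*Compactness of `Hom(L, 2)`* (`KappaHom.isKappaCompact`). A lexicographically monotone sequence of
length `κ` of `0`-`1`-sequences converges coordinatewise, since `κ` is regular, and `κ → (κ)²₂` yields
a monotone subsequence of any given sequence (`IsWeaklyCompact.exists_eventually_const`). As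
`#L ≤ κ`, the elements of `L` can serve as coordinates. If an open cover had no small subcover,
homomorphisms avoiding longer and longer parts of it would have a convergent subsequence; its limit
agrees with one of them on every set of fewer than `κ` elements, hence is itself a homomorphism, and
it avoids the whole cover. The same convergence principle shows that `κ` is a strong limit
(`IsWeaklyCompact.two_power_lt`), so that a set of size `κ` has only `κ` small subsets.

*Enough homomorphisms into `2`* (`IsKappaDistributive.exists_hom`). If `p ≰ q` in a `κ`-distributive
lattice of size at most `κ`, there is a homomorphism that sends `p` to `1` and `q` to `0`. The small
subsets of `L` are listed in order type `κ`, each cofinally often, and one grows a tree from `p` in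
which a node below the join of the subset listed at its level branches over the elements of this
subset. Distributivity provides a branch that never falls below `q`, and the filter generated by it
is `κ`-complete and `κ`-prime. That each node lies below the join of its successors needs binary meets
to distribute over small joins, which is itself an instance of `κ`-distributivity
(`IsKappaDistributive.le_of_forall_inf_le`).

With these, evaluation `L → Hom(Hom(L, 2), 2)` is an order embedding by the second result, and onto by
the first (`IsKappaDistributive.exists_evalIso`). On the side of spaces, joins and meets of fewer
than `κ` clopen upsets are unions and intersections, so `κ`-distributivity is checked pointwise by
following a point along a branch (`IsKappaSpace.isKappaDistributive`), and compactness makes every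
homomorphism on the clopen upsets an evaluation (`IsKappaPriestley.exists_evalIso`). Evaluation is
natural, which gives the equivalence.
-/

/-! ### Combinatorics of weakly compact cardinals -/

section WeaklyCompact

variable {κ : Cardinal.{u}}

theorem mk_Iio_lt_of_toType_ord (i : κ.ord.ToType) : #(Set.Iio i) < κ := by
  have h := mk_Iio_lt i (by rw [mk_ord_toType, Ordinal.type_toType])
  rwa [mk_ord_toType] at h

theorem exists_lt_mem_of_le_mk (hκ : ℵ₀ ≤ κ) {H : Set κ.ord.ToType} (hH : κ ≤ #H)
    (b : κ.ord.ToType) : ∃ γ ∈ H, b < γ := by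
  by_contra! hc
  have h1 : H ⊆ insert b (Set.Iio b) := fun γ hγ => by
    rcases (hc γ hγ).eq_or_lt with h | h
    · exact Or.inl h
    · exact Or.inr h
  have h2 : #(insert b (Set.Iio b) : Set κ.ord.ToType) < κ :=
    (mk_insert_le).trans_lt
      (add_lt_of_lt hκ (mk_Iio_lt_of_toType_ord b) (one_lt_aleph0.trans_le hκ))
  exact absurd (hH.trans (mk_le_mk_of_subset h1)) h2.not_ge

theorem nonempty_toType_ord (hκ : ℵ₀ ≤ κ) : Nonempty κ.ord.ToType := by
  rw [← mk_ne_zero_iff, mk_ord_toType]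
  exact (aleph0_pos.trans_le hκ).ne'

/-- There is no largest ordinal below an infinite cardinal. -/
theorem noMaxOrder_toType_ord (hκ : ℵ₀ ≤ κ) : NoMaxOrder κ.ord.ToType :=
  ⟨fun b => by
    obtain ⟨γ, -, h⟩ := exists_lt_mem_of_le_mk hκ (H := Set.univ) (by simp) b
    exact ⟨γ, h⟩⟩

theorem exists_range_eq {α : Type u} {S : Set α} (hne : S.Nonempty) (hS : #S ≤ κ) :
    ∃ e : κ.ord.ToType → α, Set.range e = S := by
  rw [← mk_ord_toType κ] at hS
  obtain ⟨i⟩ := (Cardinal.le_def _ _).1 hS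
  have := hne.to_subtype
  refine ⟨fun k => (Function.invFun i k : S), ?_⟩
  rw [Set.range_comp' Subtype.val, (Function.invFun_surjective i.injective).range_eq,
    Set.image_univ, Subtype.range_coe]

namespace IsWeaklyCompact

/-- Regularity of a weakly compact cardinal. If `f` were unbounded, `κ` would be partitioned into
`#S` bounded pieces; the graph joining the points of one piece has neither a clique nor an
independent set of size `κ`. -/
theorem exists_upperBound (hκ : IsWeaklyCompact κ) {S : Type u} (hS : #S < κ)
    (f : S → κ.ord.ToType) : ∃ b, ∀ s, f s ≤ b := by
  by_contra! hc
  choose c hcf using hc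
  obtain ⟨H, hH, hcl | hind⟩ := hκ.2 κ.ord.ToType
    (SimpleGraph.fromRel fun γ δ => c γ = c δ) (by simp)
  · obtain ⟨γ, hγ⟩ : H.Nonempty := by
      rw [Set.nonempty_iff_ne_empty]
      rintro rfl
      rw [mk_eq_zero] at hH
      exact (aleph0_pos.trans_le hκ.1).ne hH
    obtain ⟨δ, hδ, hlt⟩ := exists_lt_mem_of_le_mk hκ.1 hH.ge (max γ (f (c γ)))
    have hadj := hcl hγ hδ ((le_max_left _ _).trans_lt hlt).ne
    rw [SimpleGraph.fromRel_adj] at hadj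
    have : c γ = c δ := hadj.2.elim id Eq.symm
    exact absurd (hcf δ) (this ▸ ((le_max_right _ _).trans_lt hlt).not_gt)
  · have hinj : Function.Injective fun γ : H => c γ := by
      intro γ δ h
      by_contra hne
      refine hind γ.2 δ.2 (fun h' => hne (Subtype.ext h')) ?_
      rw [SimpleGraph.fromRel_adj]
      exact ⟨fun h' => hne (Subtype.ext h'), Or.inl h⟩
    exact absurd (hH.ge.trans (mk_le_of_injective hinj)) hS.not_ge

/-- A lexicographically nondecreasing sequence of length `κ` of `0`-`1`-sequences converges
coordinatewise: once the coordinates before `a` have stabilized, coordinate `a` is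
nondecreasing. -/
theorem eventually_const_of_lex_mono (hκ : IsWeaklyCompact κ) {α : Type u} [LinearOrder α]
    [WellFoundedLT α] (hα : ∀ a : α, #(Set.Iio a) < κ) (h : κ.ord.ToType → α → Bool)
    (H : Set κ.ord.ToType)
    (hH : ∀ γ ∈ H, ∀ δ ∈ H, γ < δ → ∀ a, (∀ a' < a, h γ a' = h δ a') → h γ a ≤ h δ a) (a : α) :
    ∃ b, ∀ γ ∈ H, ∀ δ ∈ H, b ≤ γ → b ≤ δ → h γ a = h δ a := by
  induction a using WellFoundedLT.induction with
  | ind a ih =>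
    choose b hb using ih
    obtain ⟨B, hB⟩ := hκ.exists_upperBound (hα a) fun a' => b a'.1 a'.2
    have hagree : ∀ γ ∈ H, ∀ δ ∈ H, B ≤ γ → B ≤ δ → ∀ a' < a, h γ a' = h δ a' :=
      fun γ hγ δ hδ h1 h2 a' ha' =>
        hb a' ha' γ hγ δ hδ ((hB ⟨a', ha'⟩).trans h1) ((hB ⟨a', ha'⟩).trans h2)
    by_cases hex : ∃ γ ∈ H, B ≤ γ ∧ h γ a = true
    · obtain ⟨γ₀, hγ₀, hBγ₀, hγ₀a⟩ := hex
      have key : ∀ γ ∈ H, γ₀ ≤ γ → h γ a = true := fun γ hγ hle => by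
        rcases hle.eq_or_lt with rfl | hlt
        · exact hγ₀a
        · exact top_le_iff.1 (hγ₀a.ge.trans
            (hH γ₀ hγ₀ γ hγ hlt a (hagree γ₀ hγ₀ γ hγ hBγ₀ (hBγ₀.trans hle))))
      exact ⟨γ₀, fun γ hγ δ hδ h1 h2 => (key γ hγ h1).trans (key δ hδ h2).symm⟩
    · push Not at hex
      exact ⟨B, fun γ hγ δ hδ h1 h2 => by
        rw [Bool.eq_false_iff.2 (hex γ hγ h1), Bool.eq_false_iff.2 (hex δ hδ h2)]⟩

/-- Every sequence of length `κ` of `0`-`1`-sequences has a subsequence of length `κ` that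
converges coordinatewise: the partition relation gives a lexicographically monotone one. -/
theorem exists_eventually_const (hκ : IsWeaklyCompact κ) {α : Type u} [LinearOrder α]
    [WellFoundedLT α] (hα : ∀ a : α, #(Set.Iio a) < κ) (h : κ.ord.ToType → α → Bool) :
    ∃ H : Set κ.ord.ToType, #H = κ ∧
      ∀ a, ∃ b, ∀ γ ∈ H, ∀ δ ∈ H, b ≤ γ → b ≤ δ → h γ a = h δ a := by
  obtain ⟨H, hH, hcl | hind⟩ := hκ.2 κ.ord.ToType
    (SimpleGraph.fromRel fun γ δ => γ < δ ∧ toLex (h γ) ≤ toLex (h δ)) (by simp)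
  · refine ⟨H, hH, hκ.eventually_const_of_lex_mono hα h H fun γ hγ δ hδ hlt a ha => ?_⟩
    have hadj := hcl hγ hδ hlt.ne
    rw [SimpleGraph.fromRel_adj] at hadj
    have hle : toLex (h γ) ≤ toLex (h δ) := hadj.2.elim And.right fun h' => absurd h'.1 hlt.not_gt
    by_contra hnle
    exact absurd hle (not_le.2 ⟨a, fun a' ha' => (ha a' ha').symm, not_le.1 hnle⟩)
  · refine ⟨H, hH, fun a => ?_⟩
    -- complementing every coordinate reverses the lexicographic order
    obtain ⟨b, hb⟩ := hκ.eventually_const_of_lex_mono hα (fun γ a => !(h γ a)) H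
      (fun γ hγ δ hδ hlt a ha => by
        have hnadj : ¬ SimpleGraph.Adj _ γ δ := hind hγ hδ hlt.ne
        rw [SimpleGraph.fromRel_adj] at hnadj
        have hle : toLex (h δ) < toLex (h γ) := by
          by_contra hc
          exact hnadj ⟨hlt.ne, Or.inl ⟨hlt, not_lt.1 hc⟩⟩
        by_contra hnle
        refine absurd hle (not_lt.2 (le_of_lt ⟨a, fun a' ha' => ?_, ?_⟩))
        · simpa using ha a' ha'
        · revert hnle
          change ¬ ((!(h γ a)) ≤ !(h δ a)) → h γ a < h δ a
          cases h γ a <;> cases h δ a <;> decide) a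
    exact ⟨b, fun γ hγ δ hδ h1 h2 => by simpa using hb γ hγ δ hδ h1 h2⟩

/-- Weakly compact cardinals are strong limits: a sequence of `κ` distinct elements of `2^x` has no
subsequence of length `κ` that is eventually constant. -/
theorem two_power_lt (hκ : IsWeaklyCompact κ) {x : Cardinal.{u}} (hx : x < κ) : 2 ^ x < κ := by
  by_contra! hle
  have hcard : #κ.ord.ToType ≤ #(x.ord.ToType → Bool) := by simpa using hle
  obtain ⟨h⟩ := (Cardinal.le_def _ _).1 hcard
  obtain ⟨H, hH, hev⟩ := hκ.exists_eventually_const (α := x.ord.ToType)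
    (fun a => (mk_Iio_lt_of_toType_ord a).trans hx) h
  choose b hb using hev
  obtain ⟨B, hB⟩ := hκ.exists_upperBound (S := x.ord.ToType) (by simpa using hx) b
  obtain ⟨γ, hγ, h1⟩ := exists_lt_mem_of_le_mk hκ.1 hH.ge B
  obtain ⟨δ, hδ, h2⟩ := exists_lt_mem_of_le_mk hκ.1 hH.ge γ
  refine h2.ne (h.injective (funext fun a => ?_))
  exact hb a γ hγ δ hδ ((hB a).trans h1.le) ((hB a).trans (h1.trans h2).le)

/-- `κ^{<κ} = κ`: a set of size at most `κ` has at most `κ` subsets of size less than `κ`. -/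
theorem mk_small_subsets_le (hκ : IsWeaklyCompact κ) {α : Type u} (hα : #α ≤ κ) :
    #{S : Set α // #S < κ} ≤ κ := by
  have hcard : #α ≤ #κ.ord.ToType := by simpa using hα
  obtain ⟨i⟩ := (Cardinal.le_def _ _).1 hcard
  have hnm := noMaxOrder_toType_ord hκ.1
  have hb : #{S : Set κ.ord.ToType // Set.Bounded (· < ·) S} = #κ.ord.ToType :=
    mk_bounded_subset (r := (· < ·)) (by
      intro x hx
      rw [mk_ord_toType] at hx ⊢
      exact hκ.two_power_lt hx) (by rw [mk_ord_toType, Ordinal.type_toType])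
  rw [mk_ord_toType] at hb
  refine le_of_le_of_eq ?_ hb
  refine mk_le_of_injective (f := fun S => ⟨i '' S.1, ?_⟩) ?_
  · obtain ⟨b, hb⟩ := hκ.exists_upperBound (mk_image_le.trans_lt S.2)
      (fun s : i '' S.1 => (s : κ.ord.ToType))
    obtain ⟨b', hb'⟩ := exists_gt b
    exact ⟨b', fun s hs => (hb ⟨s, hs⟩).trans_lt hb'⟩
  · intro S T h
    exact Subtype.ext (i.injective.image_injective (Subtype.ext_iff.1 h))

/-- A nonempty set of size at most `κ` has an enumeration of length `κ` in which every element
occurs cofinally often. -/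
theorem exists_cofinal_enumeration (hκ : IsWeaklyCompact κ) {α : Type u} [Nonempty α]
    (hα : #α ≤ κ) : ∃ e : κ.ord.ToType → α, ∀ a b, ∃ γ, b ≤ γ ∧ e γ = a := by
  have hne := nonempty_toType_ord hκ.1
  have hcard : #(α × κ.ord.ToType) ≤ #κ.ord.ToType := by
    rw [mk_prod, lift_id, lift_id, mk_ord_toType]
    exact (mul_le_mul_left hα κ).trans (mul_eq_self hκ.1).le
  obtain ⟨i⟩ := (Cardinal.le_def _ _).1 hcard
  refine ⟨fun γ => (Function.invFun i γ).1, fun a b => ?_⟩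
  have hinj : Function.Injective fun γ => i (a, γ) := fun γ δ h => by
    simpa using i.injective h
  obtain ⟨_, ⟨γ, rfl⟩, h⟩ := exists_lt_mem_of_le_mk hκ.1 (H := Set.range fun γ => i (a, γ))
    (by rw [mk_range_eq _ hinj, mk_ord_toType]) b
  exact ⟨i (a, γ), h.le, by
    change (Function.invFun i (i (a, γ))).1 = a
    rw [Function.leftInverse_invFun i.injective]⟩

end IsWeaklyCompact

end WeaklyCompact

/-! ### Nodes as restrictions of branches -/

namespace KappaNode

variable {κ : Cardinal.{u}}

theorem exists_eq_ofBranch (f : KappaNode κ) : ∃ x β, f = ofBranch x β := by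
  classical
  refine ⟨fun i => if h : i < f.1 then f.2 ⟨i, h⟩ else i, f.1, ?_⟩
  obtain ⟨β, f⟩ := f
  refine Sigma.ext rfl (heq_of_eq (funext fun i => ?_))
  change f i = if h : i.1 < β then f ⟨i.1, h⟩ else i.1
  rw [dif_pos (show i.1 < β from i.2)]

theorem ofBranch_congr {x y : κ.ord.ToType → κ.ord.ToType} {β : κ.ord.ToType}
    (h : ∀ γ < β, x γ = y γ) : ofBranch x β = ofBranch y β :=
  Sigma.ext rfl (heq_of_eq (funext fun i => h i.1 i.2))

theorem isPrefix_ofBranch_iff {g : KappaNode κ} {x : κ.ord.ToType → κ.ord.ToType}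
    {β : κ.ord.ToType} : g.IsPrefix (ofBranch x β) ↔ ∃ γ ≤ β, g = ofBranch x γ := by
  constructor
  · rintro ⟨h, hg⟩
    refine ⟨g.1, h, ?_⟩
    obtain ⟨γ, g⟩ := g
    exact Sigma.ext rfl (heq_of_eq (funext hg))
  · rintro ⟨γ, h, rfl⟩
    exact ⟨h, fun _ => rfl⟩

theorem IsPrefix.trans {f g h : KappaNode κ} (hfg : f.IsPrefix g) (hgh : g.IsPrefix h) :
    f.IsPrefix h :=
  ⟨hfg.1.trans hgh.1, fun i => (hfg.2 i).trans (hgh.2 _)⟩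

theorem setOf_isPrefix_ofBranch (x : κ.ord.ToType → κ.ord.ToType) (β : κ.ord.ToType) :
    {g | g.IsPrefix (ofBranch x β)} = ofBranch x '' Set.Iic β := by
  ext g
  rw [Set.mem_ofPred_eq, isPrefix_ofBranch_iff]
  exact ⟨fun ⟨γ, h, e⟩ => ⟨γ, h, e.symm⟩, fun ⟨γ, h, e⟩ => ⟨γ, h, e.symm⟩⟩

theorem setOf_isPrefix_ne_ofBranch (x : κ.ord.ToType → κ.ord.ToType) (β : κ.ord.ToType) :
    {g | g.IsPrefix (ofBranch x β) ∧ g ≠ ofBranch x β} = ofBranch x '' Set.Iio β := by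
  ext g
  rw [Set.mem_ofPred_eq, isPrefix_ofBranch_iff]
  constructor
  · rintro ⟨⟨γ, h, rfl⟩, hne⟩
    exact ⟨γ, h.lt_of_ne (by rintro rfl; exact hne rfl), rfl⟩
  · rintro ⟨γ, h, rfl⟩
    exact ⟨⟨γ, le_of_lt h, rfl⟩, fun e => (ne_of_lt h) (congrArg Sigma.fst e)⟩

theorem children_ofBranch (hκ : ℵ₀ ≤ κ) (x : κ.ord.ToType → κ.ord.ToType) (β : κ.ord.ToType) :
    (ofBranch x β).children =
      Set.range fun k => ofBranch (Function.update x β k) (Order.succ β) := by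
  have := noMaxOrder_toType_ord hκ
  ext g
  constructor
  · rintro ⟨hcov, h⟩
    obtain ⟨y, γ, rfl⟩ := g.exists_eq_ofBranch
    obtain rfl : Order.succ β = γ := hcov.succ_eq
    refine ⟨y β, ofBranch_congr fun δ hδ => ?_⟩
    rcases (Order.lt_succ_iff.1 hδ).eq_or_lt with rfl | hδ
    · simp
    · rw [Function.update_of_ne hδ.ne]
      exact h.2 ⟨δ, hδ⟩
  · rintro ⟨k, rfl⟩
    refine ⟨Order.covBy_succ β, Order.le_succ β, fun i => ?_⟩
    exact (Function.update_of_ne (show i.1 < β from i.2).ne _ _).symm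

end KappaNode

/-! ### Distributive lattices have enough points -/

section Distributive

variable {κ : Cardinal.{u}} {L : Type u} [PartialOrder L]

open KappaNode in
/-- `κ`-distributivity in terms of branches. The family is given by its values `A x β` along the
branches `x`, where `A x β` depends only on `x` below `β`; the bar consists of the nodes at which
the meet of the initial segments lies below `q`. -/
theorem IsKappaDistributive.le_of_branches (hd : IsKappaDistributive κ L) (hκ : ℵ₀ ≤ κ)
    (A : (κ.ord.ToType → κ.ord.ToType) → κ.ord.ToType → L)
    (hloc : ∀ x y β, (∀ γ < β, x γ = y γ) → A x β = A y β)
    (hsucc : ∀ x β, #(Set.range fun k => A (Function.update x β k) (Order.succ β)) < κ ∧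
      ∃ j, IsLUB (Set.range fun k => A (Function.update x β k) (Order.succ β)) j ∧ A x β ≤ j)
    (hlim : ∀ x β, Order.IsSuccLimit β → IsGLB (A x '' Set.Iio β) (A x β))
    {q : L} (hq : ∀ x, ∃ β, ∀ m ∈ lowerBounds (A x '' Set.Iic β), m ≤ q)
    (x : κ.ord.ToType → κ.ord.ToType) {β₀ : κ.ord.ToType} (hβ₀ : IsMin β₀) : A x β₀ ≤ q := by
  obtain ⟨a, ha⟩ : ∃ a : KappaNode κ → L, ∀ x β, a (ofBranch x β) = A x β := by
    choose X B hXB using exists_eq_ofBranch (κ := κ)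
    refine ⟨fun f => A (X f) (B f), fun x β => ?_⟩
    have h := hXB (ofBranch x β)
    have hB : β = B (ofBranch x β) := congrArg Sigma.fst h
    rw [← hB] at h
    change A _ (B (ofBranch x β)) = A x β
    rw [← hB]
    refine hloc _ _ _ fun γ hγ => ?_
    have h2 := eq_of_heq (Sigma.ext_iff.1 h).2
    exact (congrFun h2 ⟨γ, hγ⟩).symm
  have hlub := hd a (fun f => by
      obtain ⟨x, β, rfl⟩ := f.exists_eq_ofBranch
      have : a '' (ofBranch x β).children =
          Set.range fun k => A (Function.update x β k) (Order.succ β) := by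
        rw [children_ofBranch hκ, ← Set.range_comp]
        exact congrArg Set.range (funext fun k => ha _ _)
      rw [this, ha]
      exact hsucc x β)
    (fun f hf => by
      obtain ⟨x, β, rfl⟩ := f.exists_eq_ofBranch
      rw [setOf_isPrefix_ne_ofBranch, Set.image_image, ha]
      simp only [ha]
      exact hlim x β hf)
    {f | ∀ m ∈ lowerBounds (a '' {g | g.IsPrefix f}), m ≤ q}
    ⟨fun f g hf hfg m hm => hf m fun _ ⟨g', hg', e⟩ => hm ⟨g', hg'.trans hfg, e⟩, fun x => by
      obtain ⟨β, hβ⟩ := hq x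
      refine ⟨β, fun m hm => hβ m ?_⟩
      rw [setOf_isPrefix_ofBranch, Set.image_image] at hm
      simpa only [ha] using hm⟩
    (ofBranch x β₀) hβ₀
  rw [ha] at hlub
  exact hlub.2 fun m ⟨f, hf, hm⟩ => hf.1 m hm.1

/-- Binary meets distribute over joins of fewer than `κ` elements. The elements of `S` are placed on
the first level of the tree, and `p` at the root; from the first limit level on, each branch
continues with the meet of `p` with its element of `S`. -/
theorem IsKappaDistributive.le_of_forall_inf_le [KappaComplete κ L]
    (hd : IsKappaDistributive κ L) (hκ : ℵ₀ ≤ κ) {S : Set L} (hS : #S < κ) {j p q : L}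
    (hj : IsLUB S j) (hpj : p ≤ j) (hq : ∀ s ∈ S, ∀ m, m ≤ p → m ≤ s → m ≤ q) : p ≤ q := by
  classical
  have := noMaxOrder_toType_ord hκ
  have hne := nonempty_toType_ord hκ
  obtain ⟨z, hz⟩ : ∃ z : κ.ord.ToType, IsBot z :=
    ⟨WellFounded.min wellFounded_lt Set.univ Set.univ_nonempty,
      fun b => WellFounded.min_le wellFounded_lt (Set.mem_univ b)⟩
  have hmin : IsMin z := hz.isMin
  obtain ⟨o, ho⟩ := KappaComplete.exists_isLUB (κ := κ) (∅ : Set L)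
    (by rw [mk_eq_zero]; exact aleph0_pos.trans_le hκ)
  have hbot : ∀ c, o ≤ c := fun c => ho.2 (by simp)
  -- adding the least element to `S` makes it nonempty and does not change its join
  have hS' : #(insert o S : Set L) < κ :=
    mk_insert_le.trans_lt (add_lt_of_lt hκ hS (one_lt_aleph0.trans_le hκ))
  obtain ⟨e, he⟩ := exists_range_eq (Set.insert_nonempty o S) hS'.le
  have hej : IsLUB (Set.range e) j := by
    rw [he]
    refine ⟨fun c hc => ?_, fun c hc => hj.2 fun s hs => hc (Or.inr hs)⟩
    rcases hc with rfl | hc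
    · exact hbot j
    · exact hj.1 hc
  have hinf : ∀ k, ∃ m, IsGLB {p, e k} m := fun k =>
    KappaComplete.exists_isGLB (κ := κ) _ ((Set.toFinite _).lt_aleph0.trans_le hκ)
  choose m hm using hinf
  have hmq : ∀ k c, c ≤ p → c ≤ e k → c ≤ q := fun k c hcp hce => by
    rcases he ▸ Set.mem_range_self k with h | h
    · exact hce.trans (h ▸ hbot q)
    · exact hq _ h c hcp hce
  have hzs : z < Order.succ z := Order.lt_succ z
  have hlimsucc : ∀ β : κ.ord.ToType, (∃ l, Order.IsSuccLimit l ∧ l ≤ Order.succ β) ↔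
      ∃ l, Order.IsSuccLimit l ∧ l ≤ β := fun β => by
    refine ⟨fun ⟨l, hl, h⟩ => ⟨l, hl, ?_⟩, fun ⟨l, hl, h⟩ => ⟨l, hl, h.trans (Order.le_succ β)⟩⟩
    refine Order.lt_succ_iff.1 (h.lt_of_ne ?_)
    rintro rfl
    exact Order.not_isSuccLimit_succ β hl
  have hnlim : ¬ ∃ l : κ.ord.ToType, Order.IsSuccLimit l ∧ l ≤ z := fun ⟨l, hl, h⟩ =>
    hl.1 (hmin.mono h)
  let A : (κ.ord.ToType → κ.ord.ToType) → κ.ord.ToType → L := fun x β =>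
    if ∃ l, Order.IsSuccLimit l ∧ l ≤ β then m (x z) else if β = z then p else e (x z)
  have hA0 : ∀ x, A x z = p := fun x => by simp only [A, if_neg hnlim, if_true]
  have hA1 : ∀ x, A x (Order.succ z) = e (x z) := fun x => by
    simp only [A, hlimsucc, if_neg hnlim, if_neg hzs.ne']
  have hlow : ∀ x β, z < β → m (x z) ≤ A x β := fun x β hβ => by
    simp only [A, if_neg hβ.ne']
    split_ifs
    · exact le_rfl
    · exact (hm _).1 (by simp)
  have key : ∀ x : κ.ord.ToType → κ.ord.ToType, A x z ≤ q := by
    intro x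
    refine hd.le_of_branches hκ A ?_ ?_ ?_ (q := q) ?_ x hmin
    · intro x y β h
      rcases eq_or_ne β z with rfl | hβ
      · rw [hA0, hA0]
      · simp only [A, if_neg hβ, h z ((hz β).lt_of_ne hβ.symm)]
    · intro x β
      rcases eq_or_ne β z with rfl | hβ
      · have : (Set.range fun k => A (Function.update x β k) (Order.succ β)) = Set.range e :=
          congrArg Set.range (funext fun k => by rw [hA1, Function.update_self])
        rw [this, hA0]
        exact ⟨he ▸ hS', j, hej, hpj⟩
      · have hconst : ∀ k, A (Function.update x β k) (Order.succ β) = A x β := fun k => by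
          have hβs : Order.succ β ≠ z := ((hz β).trans_lt (Order.lt_succ β)).ne'
          simp only [A, hlimsucc, if_neg hβ, if_neg hβs, Function.update_of_ne hβ.symm]
        simp only [hconst, Set.range_const]
        exact ⟨by rw [mk_singleton]; exact one_lt_aleph0.trans_le hκ, A x β, isLUB_singleton, le_rfl⟩
    · intro x β hβ
      have hzβ : z < β := (hz β).lt_of_ne (by rintro rfl; exact hβ.1 hmin)
      have hAβ : A x β = m (x z) := if_pos ⟨β, hβ, le_rfl⟩
      rw [hAβ]
      refine ⟨?_, fun c hc => (hm _).2 ?_⟩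
      · rintro _ ⟨γ, -, rfl⟩
        rcases eq_or_ne γ z with rfl | hγ
        · rw [hA0]
          exact (hm _).1 (by simp)
        · exact hlow x γ ((hz γ).lt_of_ne hγ.symm)
      · rintro _ (rfl | rfl)
        · exact hA0 x ▸ hc ⟨z, hzβ, rfl⟩
        · exact hA1 x ▸ hc ⟨_, hβ.succ_lt hzβ, rfl⟩
    · intro x
      refine ⟨Order.succ z, fun c hc => hmq (x z) c ?_ ?_⟩
      · exact hA0 x ▸ hc ⟨z, hzs.le, rfl⟩
      · exact hA1 x ▸ hc ⟨_, Set.self_mem_Iic, rfl⟩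
  exact hA0 id ▸ key id

end Distributive

section Points

variable {κ : Cardinal.{u}} {L : Type u} [PartialOrder L]

/-- A `κ`-distributive lattice of size at most `κ` has enough homomorphisms into `2`. All subsets
`S` with fewer than `κ` elements are enumerated, each cofinally often. The tree starts with `p`; a
node whose value lies below `⋁ S`, for the set `S` enumerated at its level, branches into the meets
of its value with the elements of `S`. If every branch fell below `q`, distributivity would give
`p ≤ q`; and a branch that never does generates a filter of the required kind. -/
theorem IsKappaDistributive.exists_hom [KappaComplete κ L] (hd : IsKappaDistributive κ L)
    (hκ : IsWeaklyCompact κ) (hL : #L ≤ κ) {p q : L} (hpq : ¬ p ≤ q) :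
    ∃ h : KappaHom κ L Bool, h p = true ∧ h q = false := by
  classical
  have := noMaxOrder_toType_ord hκ.1
  have h1κ : 1 < κ := one_lt_aleph0.trans_le hκ.1
  have hins : ∀ (a : L) (s : Set L), #s < κ → #(insert a s : Set L) < κ := fun a s hs =>
    mk_insert_le.trans_lt (add_lt_of_lt hκ.1 hs h1κ)
  have hempty : #(∅ : Set L) < κ := by rw [mk_eq_zero]; exact aleph0_pos.trans_le hκ.1
  obtain ⟨o, ho⟩ := KappaComplete.exists_isLUB (κ := κ) (∅ : Set L) hempty
  obtain ⟨t, ht⟩ := KappaComplete.exists_isGLB (κ := κ) (∅ : Set L) hempty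
  have hbot : ∀ c, o ≤ c := fun c => ho.2 (by simp)
  have htop : ∀ c, c ≤ t := fun c => ht.2 (by simp)
  have hglb : ∀ s : Set L, ∃ a, #s < κ → IsGLB s a := fun s => by
    by_cases hs : #s < κ
    · exact (KappaComplete.exists_isGLB s hs).imp fun a ha _ => ha
    · exact ⟨o, fun h => absurd h hs⟩
  choose glb hglb using hglb
  have hlub : ∀ S : {S : Set L // #S < κ}, ∃ a, IsLUB S.1 a := fun S =>
    KappaComplete.exists_isLUB S.1 S.2
  choose lub hlub using hlub
  have : Nonempty {S : Set L // #S < κ} := ⟨⟨∅, hempty⟩⟩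
  obtain ⟨e, he⟩ := hκ.exists_cofinal_enumeration (hκ.mk_small_subsets_le hL)
  have hrange : ∀ S : {S : Set L // #S < κ}, ∃ d : κ.ord.ToType → L,
      Set.range d = insert o S.1 := fun S =>
    exists_range_eq (Set.insert_nonempty o S.1) (hins o S.1 S.2).le
  choose d hd' using hrange
  let T : L → κ.ord.ToType → κ.ord.ToType → L := fun a k γ =>
    if a ≤ lub (e γ) then d (e γ) k else t
  -- `A x β` is the meet of `p` with the elements chosen by `x` at the levels before `β`
  obtain ⟨A, hA⟩ : ∃ A : (κ.ord.ToType → κ.ord.ToType) → κ.ord.ToType → L, ∀ x β,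
      A x β = glb (insert p (Set.range fun γ : Set.Iio β => T (A x γ) (x γ) γ)) :=
    ⟨fun x => WellFounded.fix wellFounded_lt fun β ih =>
      glb (insert p (Set.range fun γ : Set.Iio β => T (ih γ.1 (Set.mem_Iio.1 γ.2)) (x γ) γ)),
      fun x β => WellFounded.fix_eq _ _ _⟩
  have hAglb : ∀ x β,
      IsGLB (insert p (Set.range fun γ : Set.Iio β => T (A x γ) (x γ) γ)) (A x β) := fun x β => by
    rw [hA]
    exact hglb _ (hins _ _ (mk_range_le.trans_lt (mk_Iio_lt_of_toType_ord β)))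
  have hle : ∀ {x β c}, c ≤ A x β ↔ c ≤ p ∧ ∀ γ < β, c ≤ T (A x γ) (x γ) γ := fun {x β c} => by
    rw [le_isGLB_iff (hAglb x β), mem_lowerBounds, Set.forall_mem_insert, Set.forall_mem_range]
    simp
  have hanti : ∀ x {γ β}, γ ≤ β → A x β ≤ A x γ := fun x γ β h => by
    have := hle.1 (le_refl (A x β))
    exact hle.2 ⟨this.1, fun δ hδ => this.2 δ (hδ.trans_le h)⟩
  have hAp : ∀ x β, A x β ≤ p := fun x β => (hle.1 le_rfl).1
  have hstep : ∀ x {γ β}, γ < β → A x β ≤ T (A x γ) (x γ) γ := fun x γ β h => (hle.1 le_rfl).2 γ h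
  have hlesucc : ∀ {x β c}, c ≤ A x (Order.succ β) ↔ c ≤ A x β ∧ c ≤ T (A x β) (x β) β :=
    fun {x β c} => by
      refine ⟨fun h => ⟨h.trans (hanti x (Order.le_succ β)),
        h.trans (hstep x (Order.lt_succ β))⟩, fun ⟨h1, h2⟩ => hle.2 ⟨h1.trans (hAp x β), ?_⟩⟩
      intro γ hγ
      rcases (Order.lt_succ_iff.1 hγ).eq_or_lt with rfl | hγ
      · exact h2
      · exact h1.trans (hstep x hγ)
  have hloc : ∀ x y β, (∀ γ < β, x γ = y γ) → A x β = A y β := fun x y β => by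
    induction β using WellFoundedLT.induction with
    | ind β ih =>
      intro h
      rw [hA, hA]
      congr 2
      refine congrArg Set.range (funext fun γ => ?_)
      rw [h γ γ.2, ih γ γ.2 fun δ hδ => h δ (hδ.trans γ.2)]
  obtain ⟨x, hx⟩ : ∃ x, ∀ β, ¬ A x β ≤ q := by
    by_contra! hq
    obtain ⟨z, hz⟩ : ∃ z : κ.ord.ToType, IsMin z := by
      obtain ⟨b, -⟩ := hq id
      exact ⟨WellFounded.min wellFounded_lt Set.univ ⟨b, trivial⟩, fun b _ =>
        WellFounded.min_le wellFounded_lt (Set.mem_univ b)⟩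
    have hpz : p ≤ A id z := hle.2 ⟨le_rfl, fun γ hγ => absurd hγ hz.not_lt⟩
    refine hpq (hpz.trans (hd.le_of_branches hκ.1 A hloc ?_ ?_ (fun x => ?_) id hz))
    · intro x β
      have hAβ : ∀ k, A (Function.update x β k) β = A x β := fun k =>
        hloc _ _ _ fun γ hγ => Function.update_of_ne hγ.ne _ _
      have hval : ∀ {k c}, c ≤ A (Function.update x β k) (Order.succ β) ↔
          c ≤ A x β ∧ c ≤ T (A x β) k β := fun {k c} => by
        rw [hlesucc, hAβ, Function.update_self]
      have hcard : #(Set.range fun k => A (Function.update x β k) (Order.succ β)) < κ := by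
        have hsub : (Set.range fun k => A (Function.update x β k) (Order.succ β)) ⊆
            (fun s => glb {A x β, s}) '' insert t (insert o (e β).1) := by
          rintro _ ⟨k, rfl⟩
          refine ⟨T (A x β) k β, ?_, ?_⟩
          · by_cases h : A x β ≤ lub (e β)
            · simp only [T, if_pos h]
              exact Or.inr (hd' (e β) ▸ Set.mem_range_self k)
            · simp only [T, if_neg h]
              exact Or.inl rfl
          · have h2 := hglb {A x β, T (A x β) k β} ((Set.toFinite _).lt_aleph0.trans_le hκ.1)
            refine eq_of_forall_le_iff fun c => ?_
            rw [hval, le_isGLB_iff h2, mem_lowerBounds, Set.forall_mem_insert]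
            simp
        exact (mk_le_mk_of_subset hsub).trans_lt
          (mk_image_le.trans_lt (hins _ _ (hins _ _ (e β).2)))
      obtain ⟨j, hj⟩ := KappaComplete.exists_isLUB _ hcard
      refine ⟨hcard, j, hj, ?_⟩
      by_cases h : A x β ≤ lub (e β)
      · refine hd.le_of_forall_inf_le hκ.1 (e β).2 (hlub (e β)) h fun s hs m hm hms => ?_
        obtain ⟨k, rfl⟩ : s ∈ Set.range (d (e β)) := hd' (e β) ▸ Or.inr hs
        refine le_trans ?_ (hj.1 ⟨k, rfl⟩)
        refine hval.2 ⟨hm, ?_⟩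
        simpa only [T, if_pos h] using hms
      · refine le_trans ?_ (hj.1 ⟨β, rfl⟩)
        refine hval.2 ⟨le_rfl, ?_⟩
        simp only [T, if_neg h, htop]
    · intro x β hβ
      refine ⟨?_, fun c hc => hle.2 ⟨?_, fun γ hγ => ?_⟩⟩
      · rintro _ ⟨γ, hγ, rfl⟩
        exact hanti x (le_of_lt hγ)
      · obtain ⟨γ, hγ⟩ := not_isMin_iff.1 hβ.1
        exact (hc ⟨γ, hγ, rfl⟩).trans (hAp x γ)
      · exact (hc ⟨Order.succ γ, hβ.succ_lt hγ, rfl⟩).trans (hstep x (Order.lt_succ γ))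
    · obtain ⟨β, hβ⟩ := hq x
      exact ⟨β, fun m hm => (hm ⟨β, Set.self_mem_Iic, rfl⟩).trans hβ⟩
  refine ⟨⟨fun c => decide (∃ β, A x β ≤ c), fun S c hS hc => ?_, fun S c hS hc => ?_⟩, ?_, ?_⟩
  · rw [Bool.isLUB_image_decide]
    simp only [decide_eq_true_eq]
    constructor
    · rintro ⟨β, hβ⟩
      obtain ⟨γ, hβγ, hγ⟩ := he ⟨S, hS⟩ β
      have hγc : A x γ ≤ lub (e γ) := by
        rw [hγ, ← hc.unique (hlub ⟨S, hS⟩)]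
        exact (hanti x hβγ).trans hβ
      have h2 := hstep x (Order.lt_succ γ)
      simp only [T, if_pos hγc] at h2
      have hmem : d (e γ) (x γ) ∈ insert o (e γ).1 := hd' (e γ) ▸ Set.mem_range_self (x γ)
      rcases hmem with h | h
      · exact absurd (h2.trans (h ▸ hbot q)) (hx _)
      · rw [hγ] at h h2
        exact ⟨_, h, _, h2⟩
    · rintro ⟨s, hs, β, hβ⟩
      exact ⟨β, hβ.trans (hc.1 hs)⟩
  · rw [Bool.isGLB_image_decide]
    simp only [decide_eq_true_eq]
    refine ⟨fun ⟨β, hβ⟩ s hs => ⟨β, hβ.trans (hc.1 hs)⟩, fun h => ?_⟩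
    choose b hb using h
    obtain ⟨B, hB⟩ := hκ.exists_upperBound hS fun s => b s.1 s.2
    exact ⟨B, hc.2 fun s hs => (hanti x (hB ⟨s, hs⟩)).trans (hb s hs)⟩
  · obtain ⟨β⟩ := nonempty_toType_ord hκ.1
    exact decide_eq_true ⟨β, hAp x β⟩
  · exact decide_eq_false (fun ⟨β, hβ⟩ => hx β hβ)

end Points

/-! ### The space of homomorphisms into `2` -/

section Spectrum

variable {κ : Cardinal.{u}}

/-- In a `κ`-compact space, a closed set has the `κ`-compactness property itself. -/
theorem IsKappaCompact.exists_small_subcover {X : Type u} [TopologicalSpace X]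
    (hX : IsKappaCompact κ X) {C : Set X} (hC : IsClosed C) {ι : Type u} (U : ι → Set X)
    (hU : ∀ i, IsOpen (U i)) (hCU : C ⊆ ⋃ i, U i) :
    ∃ s : Set ι, #s < κ ∧ C ⊆ ⋃ i ∈ s, U i := by
  obtain ⟨T, hTS, hT, hcov⟩ := hX (insert Cᶜ (Set.range U))
    (by
      rintro V (rfl | ⟨i, rfl⟩)
      · exact hC.isOpen_compl
      · exact hU i)
    (by
      rw [Set.sUnion_insert, Set.sUnion_range, Set.eq_univ_iff_forall]
      intro x
      by_cases hx : x ∈ C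
      · exact Or.inr (hCU hx)
      · exact Or.inl hx)
  have hch : ∀ V : (T ∩ Set.range U : Set (Set X)), ∃ i, U i = V.1 := fun V => V.2.2
  choose i hi using hch
  refine ⟨Set.range i, mk_range_le.trans_lt ((mk_le_mk_of_subset Set.inter_subset_left).trans_lt hT),
    fun x hx => ?_⟩
  obtain ⟨V, hV, hxV⟩ : x ∈ ⋃₀ T := hcov ▸ Set.mem_univ x
  rcases hTS hV with rfl | hr
  · exact absurd hx hxV
  · refine Set.mem_biUnion (Set.mem_range_self ⟨V, hV, hr⟩) ?_
    rw [hi]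
    exact hxV

variable {L : Type u} [PartialOrder L]

namespace KappaHom

theorem mono (hκ : ℵ₀ ≤ κ) {M : Type v} [PartialOrder M] (h : KappaHom κ L M) {a b : L}
    (hab : a ≤ b) : h a ≤ h b :=
  (h.map_isLUB {a, b} b ((Set.toFinite _).lt_aleph0.trans_le hκ)
    ⟨by rintro _ (rfl | rfl) <;> simp [hab], fun c hc => hc (by simp)⟩).1 ⟨a, by simp, rfl⟩

theorem apply_isLUB (h : KappaHom κ L Bool) {s : Set L} {a : L} (hs : #s < κ) (ha : IsLUB s a) :
    h a = true ↔ ∃ b ∈ s, h b = true :=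
  (Bool.isLUB_image_decide s h (h a)).1 (h.map_isLUB s a hs ha)

theorem apply_isGLB (h : KappaHom κ L Bool) {s : Set L} {a : L} (hs : #s < κ) (ha : IsGLB s a) :
    h a = true ↔ ∀ b ∈ s, h b = true :=
  (Bool.isGLB_image_decide s h (h a)).1 (h.map_isGLB s a hs ha)

theorem isClopen_setOf_apply_eq (a : L) (b : Bool) : IsClopen {h : KappaHom κ L Bool | h a = b} :=
  (isClopen_discrete {b}).preimage ((continuous_apply a).comp continuous_induced_dom)

/-- The basic clopen set of the homomorphisms that send `p.1` to `1` and `p.2` to `0`. -/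
def between (κ : Cardinal.{u}) (p : L × L) : Set (KappaHom κ L Bool) :=
  {h | h p.1 = true ∧ h p.2 = false}

theorem isClopen_between (p : L × L) : IsClopen (between κ p) :=
  (isClopen_setOf_apply_eq p.1 true).inter (isClopen_setOf_apply_eq p.2 false)

/-- Fewer than `κ` basic clopen sets intersect in a basic clopen set: take the meet of the first
components and the join of the second ones. -/
theorem exists_between_eq [KappaComplete κ L] {ι : Type u} (hι : #ι < κ) (p : ι → L × L) :
    ∃ q : L × L, between κ q = ⋂ i, between κ (p i) := by
  have h1 : #(Set.range fun i => (p i).1) < κ := mk_range_le.trans_lt hι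
  have h2 : #(Set.range fun i => (p i).2) < κ := mk_range_le.trans_lt hι
  obtain ⟨a, ha⟩ := KappaComplete.exists_isGLB _ h1
  obtain ⟨b, hb⟩ := KappaComplete.exists_isLUB _ h2
  refine ⟨(a, b), Set.ext fun h => ?_⟩
  rw [Set.mem_iInter]
  change h a = true ∧ h b = false ↔ ∀ i, h (p i).1 = true ∧ h (p i).2 = false
  rw [forall_and, h.apply_isGLB h1 ha, Set.forall_mem_range, ← Bool.not_eq_true,
    h.apply_isLUB h2 hb, Set.exists_range_iff]
  simp

theorem exists_mem_between_subset [KappaComplete κ L] (hκ : ℵ₀ ≤ κ) {U : Set (KappaHom κ L Bool)}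
    (hU : IsOpen U) {h : KappaHom κ L Bool} (hh : h ∈ U) :
    ∃ p, h ∈ between κ p ∧ between κ p ⊆ U := by
  obtain ⟨W, hW, rfl⟩ := isOpen_induced_iff.1 hU
  obtain ⟨I, u, hu, hI⟩ := isOpen_pi_iff.1 hW _ hh
  obtain ⟨t, ht⟩ := KappaComplete.exists_isGLB (κ := κ) (∅ : Set L)
    (by rw [mk_eq_zero]; exact aleph0_pos.trans_le hκ)
  obtain ⟨o, ho⟩ := KappaComplete.exists_isLUB (κ := κ) (∅ : Set L)
    (by rw [mk_eq_zero]; exact aleph0_pos.trans_le hκ)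
  have h0 : #(∅ : Set L) < κ := by rw [mk_eq_zero]; exact aleph0_pos.trans_le hκ
  have htop : ∀ g : KappaHom κ L Bool, g t = true := fun g => (g.apply_isGLB h0 ht).2 (by simp)
  have hbot : ∀ g : KappaHom κ L Bool, g o = false := fun g =>
    Bool.eq_false_iff.2 fun hg => by simpa using (g.apply_isLUB h0 ho).1 hg
  obtain ⟨q, hq⟩ := exists_between_eq (κ := κ) (ι := I)
    ((lt_aleph0_of_finite I).trans_le hκ) fun i => if h i then (i.1, o) else (t, i.1)
  have key : ∀ g : KappaHom κ L Bool, g ∈ between κ q ↔ ∀ i ∈ I, g i = h i := fun g => by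
    rw [hq, Set.mem_iInter, Subtype.forall]
    refine forall₂_congr fun i hi => ?_
    cases hhi : h i
    · simp [between, htop]
    · simp [between, hbot]
  refine ⟨q, (key h).2 fun _ _ => rfl, fun g hg => hI fun i hi => ?_⟩
  change g i ∈ u i
  rw [(key g).1 hg i hi]
  exact (hu i hi).2

theorem isTopologicalBasis_between [KappaComplete κ L] (hκ : ℵ₀ ≤ κ) :
    TopologicalSpace.IsTopologicalBasis (Set.range (between κ (L := L))) :=
  TopologicalSpace.isTopologicalBasis_of_isOpen_of_nhds
    (by rintro _ ⟨p, rfl⟩; exact (isClopen_between p).2)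
    fun _ _ hh hU => by
      obtain ⟨p, hp, hpU⟩ := exists_mem_between_subset hκ hU hh
      exact ⟨_, ⟨p, rfl⟩, hp, hpU⟩

theorem isKappaSpace [KappaComplete κ L] (hκ : ℵ₀ ≤ κ) : IsKappaSpace κ (KappaHom κ L Bool) := by
  intro S hS hopen
  rw [(isTopologicalBasis_between hκ).isOpen_iff]
  intro h hh
  have hex : ∀ U : S, ∃ p, h ∈ between κ p ∧ between κ p ⊆ U.1 := fun U =>
    exists_mem_between_subset hκ (hopen U U.2) (hh U U.2)
  choose p hp hpU using hex
  obtain ⟨q, hq⟩ := exists_between_eq hS p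
  refine ⟨_, ⟨q, rfl⟩, ?_, ?_⟩
  · rw [hq]
    exact Set.mem_iInter.2 hp
  · rw [hq]
    exact fun g hg U hU => hpU ⟨U, hU⟩ (Set.mem_iInter.1 hg ⟨U, hU⟩)

/-- A `0`-`1`-valued function on `L` that agrees on every set of fewer than `κ` elements with some
homomorphism is a homomorphism: each instance of preservation involves fewer than `κ` elements. -/
theorem exists_eq_of_forall_small (hκ : ℵ₀ ≤ κ) (v : L → Bool)
    (hv : ∀ s : Set L, #s < κ → ∃ h : KappaHom κ L Bool, ∀ a ∈ s, h a = v a) :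
    ∃ g : KappaHom κ L Bool, ∀ a, g a = v a := by
  have hv' : ∀ (s : Set L) (a : L), #s < κ →
      ∃ h : KappaHom κ L Bool, h a = v a ∧ ∀ b ∈ s, h b = v b := fun s a hs => by
    obtain ⟨h, hh⟩ := hv (insert a s)
      (mk_insert_le.trans_lt (add_lt_of_lt hκ hs (one_lt_aleph0.trans_le hκ)))
    exact ⟨h, hh a (Set.mem_insert _ _), fun b hb => hh b (Set.mem_insert_of_mem _ hb)⟩
  refine ⟨⟨v, fun s a hs ha => ?_, fun s a hs ha => ?_⟩, fun _ => rfl⟩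
  · obtain ⟨h, ha', hs'⟩ := hv' s a hs
    rw [← ha', ← Set.image_congr hs']
    exact h.map_isLUB s a hs ha
  · obtain ⟨h, ha', hs'⟩ := hv' s a hs
    rw [← ha', ← Set.image_congr hs']
    exact h.map_isGLB s a hs ha

/-- `κ`-compactness of `Hom(L, 2)` for `L` of size at most `κ`. Enumerate the basic clopen sets that
are contained in a member of the cover. If no initial segment of this list covers, choose points
outside of the initial segments; the coordinatewise limit of a convergent subsequence is a
homomorphism, and lies outside of all the sets. -/
theorem isKappaCompact [KappaComplete κ L] (hκ : IsWeaklyCompact κ) (hL : #L ≤ κ) :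
    IsKappaCompact κ (KappaHom κ L Bool) := by
  intro S hopen hcov
  have hne : Nonempty L := by
    obtain ⟨t, -⟩ := KappaComplete.exists_isGLB (κ := κ) (∅ : Set L)
      (by rw [mk_eq_zero]; exact aleph0_pos.trans_le hκ.1)
    exact ⟨t⟩
  have hLL : #(Set.univ : Set (L × L)) ≤ κ := by
    rw [mk_univ, ← mul_def]
    exact (mul_le_mul' hL hL).trans (mul_eq_self hκ.1).le
  obtain ⟨e, he⟩ := exists_range_eq Set.univ_nonempty hLL
  obtain ⟨c, hc⟩ := exists_range_eq (κ := κ) (Set.univ_nonempty (α := L)) (by rwa [mk_univ])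
  by_cases hex : ∃ γ, ∀ h, ∃ δ < γ, h ∈ between κ (e δ) ∧ ∃ U ∈ S, between κ (e δ) ⊆ U
  · obtain ⟨γ, hγ⟩ := hex
    have hch : ∀ δ : {δ : Set.Iio γ // ∃ U ∈ S, between κ (e δ) ⊆ U}, ∃ U ∈ S,
      between κ (e δ.1) ⊆ U := fun δ => δ.2
    choose U hUS hU using hch
    refine ⟨Set.range U, by rintro _ ⟨δ, rfl⟩; exact hUS δ, ?_, ?_⟩
    · exact mk_range_le.trans_lt ((mk_subtype_le _).trans_lt (mk_Iio_lt_of_toType_ord γ))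
    · refine Set.eq_univ_of_forall fun h => ?_
      obtain ⟨δ, hδ, hmem, hgood⟩ := hγ h
      exact ⟨_, ⟨⟨⟨δ, hδ⟩, hgood⟩, rfl⟩, hU ⟨⟨δ, hδ⟩, hgood⟩ hmem⟩
  · exfalso
    push Not at hex
    choose h hh using hex
    obtain ⟨H, hH, hev⟩ := hκ.exists_eventually_const (α := κ.ord.ToType)
      mk_Iio_lt_of_toType_ord fun γ i => h γ (c i)
    have hev' : ∀ a, ∃ b v, ∀ γ ∈ H, b ≤ γ → h γ a = v := fun a => by
      obtain ⟨i, rfl⟩ : a ∈ Set.range c := hc ▸ Set.mem_univ a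
      obtain ⟨b, hb⟩ := hev i
      obtain ⟨γ, hγ, hlt⟩ := exists_lt_mem_of_le_mk hκ.1 hH.ge b
      exact ⟨b, h γ (c i), fun δ hδ hle => hb δ hδ γ hγ hle hlt.le⟩
    choose b v hbv using hev'
    obtain ⟨g, hg⟩ := exists_eq_of_forall_small hκ.1 v fun s hs => by
      obtain ⟨B, hB⟩ := hκ.exists_upperBound hs fun a => b a.1
      obtain ⟨γ, hγ, hlt⟩ := exists_lt_mem_of_le_mk hκ.1 hH.ge B
      exact ⟨h γ, fun a ha => hbv a γ hγ ((hB ⟨a, ha⟩).trans hlt.le)⟩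
    obtain ⟨U, hU, hgU⟩ : g ∈ ⋃₀ S := hcov ▸ Set.mem_univ g
    obtain ⟨p, hp, hpU⟩ := exists_mem_between_subset hκ.1 (hopen U hU) hgU
    obtain ⟨δ, rfl⟩ : p ∈ Set.range e := he ▸ Set.mem_univ p
    obtain ⟨γ, hγ, hlt⟩ := exists_lt_mem_of_le_mk hκ.1 hH.ge
      (max δ (max (b (e δ).1) (b (e δ).2)))
    simp only [max_lt_iff] at hlt
    refine hh γ δ hlt.1 ⟨?_, ?_⟩ U hU hpU
    · rw [hbv _ γ hγ hlt.2.1.le, ← hg]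
      exact hp.1
    · rw [hbv _ γ hγ hlt.2.2.le, ← hg]
      exact hp.2

theorem isKappaPriestley [KappaComplete κ L] (hκ : IsWeaklyCompact κ) (hL : #L ≤ κ) :
    IsKappaPriestley κ (KappaHom κ L Bool) where
  t2 := T2Space.of_injective_continuous DFunLike.coe_injective continuous_induced_dom
  kappaSpace := isKappaSpace hκ.1
  clopenBasis := TopologicalSpace.isTopologicalBasis_of_isOpen_of_nhds (fun _ h => h.2)
    fun _ _ hh hU => by
      obtain ⟨p, hp, hpU⟩ := exists_mem_between_subset hκ.1 hU hh
      exact ⟨_, isClopen_between p, hp, hpU⟩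
  kappaCompact := isKappaCompact hκ hL
  priestley := ⟨fun {g h} hgh => by
    obtain ⟨a, ha⟩ : ∃ a, ¬ g a ≤ h a := not_forall.1 hgh
    refine ⟨_, isClopen_setOf_apply_eq a true, fun f f' hff' hf => ?_, ?_, ?_⟩
    · exact top_le_iff.1 ((show f a = true from hf).ge.trans (hff' a))
    · by_contra hc
      exact ha ((Bool.eq_false_iff.2 hc).le.trans bot_le)
    · exact fun hc => ha (le_top.trans (show h a = true from hc).ge)⟩

theorem weightLE [KappaComplete κ L] (hκ : ℵ₀ ≤ κ) (hL : #L ≤ κ) :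
    WeightLE κ (KappaHom κ L Bool) := by
  refine ⟨_, isTopologicalBasis_between hκ, mk_range_le.trans ?_⟩
  rw [← mul_def]
  exact (mul_le_mul' hL hL).trans (mul_eq_self hκ).le

/-- Every clopen upset of `Hom(L, 2)` consists of the homomorphisms that send some fixed `a` to
`1`. -/
theorem exists_eq_setOf_apply [KappaComplete κ L]
    (hκ : IsWeaklyCompact κ) (hL : #L ≤ κ) {U : Set (KappaHom κ L Bool)} (hU : IsClopen U)
    (hU' : IsUpperSet U) : ∃ a : L, U = {h | h a = true} := by
  have hcpt := isKappaCompact (L := L) hκ hL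
  have hex : ∀ h : U, ∃ a : L, h.1 a = true ∧ ∀ g : KappaHom κ L Bool, g a = true → g ∈ U := by
    intro h
    obtain ⟨s, hs, hcov⟩ := hcpt.exists_small_subcover hU.compl.1
      (fun a : {a : L // h.1 a = true} => {g : KappaHom κ L Bool | g a = false})
      (fun a => (isClopen_setOf_apply_eq a.1 false).2) (fun g hg => by
        obtain ⟨a, ha⟩ : ∃ a, ¬ h.1 a ≤ g a := not_forall.1 fun hle => hg (hU' hle h.2)
        have h1 : h.1 a = true := by
          by_contra hc
          exact ha ((Bool.eq_false_iff.2 hc).le.trans bot_le)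
        exact Set.mem_iUnion.2 ⟨⟨a, h1⟩, Bool.eq_false_iff.2 fun hc => ha (le_top.trans hc.ge)⟩)
    have hs' := mk_image_le (f := Subtype.val) |>.trans_lt hs
    obtain ⟨a, ha⟩ := KappaComplete.exists_isGLB _ hs'
    refine ⟨a, (h.1.apply_isGLB hs' ha).2 ?_, fun g hg => ?_⟩
    · rintro _ ⟨b, -, rfl⟩
      exact b.2
    · by_contra hgU
      obtain ⟨b, hb, hgb⟩ := Set.mem_iUnion₂.1 (hcov hgU)
      exact absurd ((g.apply_isGLB hs' ha).1 hg b ⟨b, hb, rfl⟩) (Bool.eq_false_iff.1 hgb)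
  choose a ha haU using hex
  obtain ⟨s, hs, hcov⟩ := hcpt.exists_small_subcover hU.1
    (fun h : U => {g : KappaHom κ L Bool | g (a h) = true})
    (fun h => (isClopen_setOf_apply_eq (a h) true).2)
    fun g hg => Set.mem_iUnion.2 ⟨⟨g, hg⟩, ha ⟨g, hg⟩⟩
  have hs' := mk_image_le (f := a) |>.trans_lt hs
  obtain ⟨b, hb⟩ := KappaComplete.exists_isLUB _ hs'
  refine ⟨b, Set.ext fun g => (Iff.trans ?_ (g.apply_isLUB hs' hb).symm)⟩
  constructor
  · intro hg
    obtain ⟨h, hh, hgh⟩ := Set.mem_iUnion₂.1 (hcov hg)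
    exact ⟨_, ⟨h, hh, rfl⟩, hgh⟩
  · rintro ⟨_, ⟨h, -, rfl⟩, hg⟩
    exact haU h g hg

end KappaHom

/-- Evaluation at an element of `L`. -/
def KappaHom.evalAt (κ : Cardinal.{u}) (a : L) : KappaHom κ L Bool →Co Bool where
  toFun h := h a
  monotone' _ _ h := h a
  continuous_toFun := (continuous_apply a).comp continuous_induced_dom

theorem IsKappaDistributive.exists_evalIso [KappaComplete κ L] (hd : IsKappaDistributive κ L)
    (hκ : IsWeaklyCompact κ) (hL : #L ≤ κ) :
    ∃ φ : L ≃o (KappaHom κ L Bool →Co Bool), ∀ a h, φ a h = h a := by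
  have hle : ∀ a b : L, KappaHom.evalAt κ a ≤ KappaHom.evalAt κ b ↔ a ≤ b := fun a b => by
    refine ⟨fun hab => ?_, fun hab (h : KappaHom κ L Bool) => h.mono hκ.1 hab⟩
    by_contra hn
    obtain ⟨h, ha, hb⟩ := hd.exists_hom hκ hL hn
    have : h a ≤ h b := hab h
    rw [ha, hb] at this
    exact absurd this (by decide)
  refine ⟨RelIso.ofSurjective (OrderEmbedding.ofMapLEIff (KappaHom.evalAt κ) hle) fun g => ?_,
    fun _ _ => rfl⟩
  obtain ⟨a, ha⟩ := KappaHom.exists_eq_setOf_apply hκ hL g.isClopen_preimage_true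
    fun _ _ hle h => top_le_iff.1 (h.ge.trans (g.monotone' hle))
  refine ⟨a, DFunLike.ext _ _ fun h => ?_⟩
  rw [Bool.eq_iff_iff]
  exact (Set.ext_iff.1 ha h).symm

end Spectrum

/-! ### The lattice of clopen upsets -/

section ClopenUpsets

variable {κ : Cardinal.{u}} {X : Type u} [TopologicalSpace X] [PartialOrder X]

theorem IsKappaSpace.apply_isLUB (hX : IsKappaSpace κ X) {s : Set (X →Co Bool)} (hs : #s < κ)
    {a : X →Co Bool} (ha : IsLUB s a) (x : X) : a x = true ↔ ∃ g ∈ s, g x = true := by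
  obtain ⟨b, hb, h⟩ := hX.exists_join s hs
  rw [ha.unique hb, h]

theorem IsKappaSpace.apply_isGLB (hX : IsKappaSpace κ X) {s : Set (X →Co Bool)} (hs : #s < κ)
    {a : X →Co Bool} (ha : IsGLB s a) (x : X) : a x = true ↔ ∀ g ∈ s, g x = true := by
  obtain ⟨b, hb, h⟩ := hX.exists_meet s hs
  rw [ha.unique hb, h]

/-- There are at most `κ` clopen upsets: each is a union of fewer than `κ` members of a fixed basis of
size at most `κ`. -/
theorem IsKappaCompact.mk_continuousOrderHom_le (hX : IsKappaCompact κ X)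
    (hκ : IsWeaklyCompact κ) (hw : WeightLE κ X) : #(X →Co Bool) ≤ κ := by
  obtain ⟨B, hB, hBκ⟩ := hw
  have hex : ∀ g : X →Co Bool, ∃ S : Set B, #S < κ ∧ {x | g x = true} = ⋃ V ∈ S, V.1 := fun g => by
    have hg := g.isClopen_preimage_true
    obtain ⟨s, hs, hcov⟩ := hX.exists_small_subcover hg.1
      (fun V : {V : B // V.1 ⊆ {x | g x = true}} => V.1.1) (fun V => hB.isOpen V.1.2)
      fun x hx => by
        obtain ⟨V, hV, hxV, hVg⟩ := hB.exists_subset_of_mem_open hx hg.2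
        exact Set.mem_iUnion.2 ⟨⟨⟨V, hV⟩, hVg⟩, hxV⟩
    refine ⟨Subtype.val '' s, mk_image_le.trans_lt hs, Set.Subset.antisymm ?_ ?_⟩
    · rwa [Set.biUnion_image]
    · rw [Set.biUnion_image]
      exact Set.iUnion₂_subset fun V _ => V.2
  choose S hS hgS using hex
  refine le_trans (mk_le_of_injective (f := fun g => (⟨S g, hS g⟩ : {S : Set B // #S < κ})) ?_)
    (hκ.mk_small_subsets_le hBκ)
  intro g g' h
  have h' : S g = S g' := congrArg Subtype.val h
  refine DFunLike.ext _ _ fun x => ?_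
  rw [Bool.eq_iff_iff]
  exact Set.ext_iff.1 ((hgS g).trans (h' ▸ (hgS g').symm)) x

open KappaNode in
/-- Clopen upsets satisfy `κ`-distributivity pointwise: a point of the clopen upset at the root can be
followed along a branch of the tree all of whose members contain it, and this branch meets the
bar. -/
theorem IsKappaSpace.isKappaDistributive (hX : IsKappaSpace κ X) (hκ : ℵ₀ ≤ κ) :
    IsKappaDistributive κ (X →Co Bool) := by
  classical
  intro a hsucc hlim U hU r hr
  have := noMaxOrder_toType_ord hκ
  obtain ⟨y₀, β₀, rfl⟩ := r.exists_eq_ofBranch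
  replace hr : IsMin β₀ := hr
  have hroot : ∀ y, ofBranch y β₀ = ofBranch y₀ β₀ := fun y =>
    ofBranch_congr fun γ hγ => absurd hγ hr.not_lt
  refine ⟨?_, fun c hc x => ?_⟩
  · rintro m ⟨f, -, hm⟩
    obtain ⟨y, β, rfl⟩ := f.exists_eq_ofBranch
    exact hm.1 ⟨_, isPrefix_ofBranch_iff.2 ⟨β₀, hr.isBot β, rfl⟩, congrArg a (hroot y)⟩
  · cases hx : a (ofBranch y₀ β₀) x
    · exact bot_le
    have hstep : ∀ (y : κ.ord.ToType → κ.ord.ToType) β, ∃ k, a (ofBranch y β) x = true →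
        a (ofBranch (Function.update y β k) (Order.succ β)) x = true := fun y β => by
      by_cases h : a (ofBranch y β) x = true
      · obtain ⟨hcard, j, hj, hle⟩ := hsucc (ofBranch y β)
        have hjx : j x = true := top_le_iff.1 (h.ge.trans (hle x))
        obtain ⟨_, ⟨g, hg, rfl⟩, hgx⟩ := (hX.apply_isLUB hcard hj x).1 hjx
        rw [children_ofBranch hκ] at hg
        obtain ⟨k, rfl⟩ := hg
        exact ⟨k, fun _ => hgx⟩
      · exact ⟨β, fun h' => absurd h' h⟩
    choose K hK using hstep
    -- `y β` is chosen by `K` from the restriction of `y` to `β`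
    obtain ⟨y, hy⟩ : ∃ y : κ.ord.ToType → κ.ord.ToType, ∀ β,
        y β = K (fun γ => if γ < β then y γ else γ) β :=
      ⟨WellFounded.fix wellFounded_lt fun β ih => K (fun γ => if h : γ < β then ih γ h else γ) β,
        fun β => by
          refine (WellFounded.fix_eq _ _ _).trans ?_
          simp only [dite_eq_ite]⟩
    have hbranch : ∀ β, a (ofBranch y β) x = true := fun β => by
      induction β using WellFoundedLT.induction with
      | ind β ih =>
        by_cases hmin : IsMin β
        · obtain rfl : β = β₀ := le_antisymm (hmin.isBot β₀) (hr.isBot β)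
          rw [hroot, hx]
        by_cases hl : Order.IsSuccPrelimit β
        · have hg := hlim (ofBranch y β) ⟨hmin, hl⟩
          rw [setOf_isPrefix_ne_ofBranch, Set.image_image] at hg
          refine (hX.apply_isGLB (mk_image_le.trans_lt (mk_Iio_lt_of_toType_ord β)) hg x).2 ?_
          rintro _ ⟨γ, hγ, rfl⟩
          exact ih γ hγ
        · obtain ⟨γ, hγ⟩ : ∃ γ, γ ⋖ β := by
            rw [Order.IsSuccPrelimit] at hl
            push Not at hl
            exact hl
          obtain rfl : Order.succ γ = β := hγ.succ_eq
          have h1 : ofBranch (fun δ => if δ < γ then y δ else δ) γ = ofBranch y γ :=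
            ofBranch_congr fun δ hδ => if_pos hδ
          have h2 := hK (fun δ => if δ < γ then y δ else δ) γ
            (by rw [h1]; exact ih γ (Order.lt_succ γ))
          rw [← hy] at h2
          rw [← h2]
          congr 2
          refine ofBranch_congr fun δ hδ => ?_
          rcases (Order.lt_succ_iff.1 hδ).eq_or_lt with rfl | hδ
          · simp
          · simp [Function.update_of_ne hδ.ne, hδ]
    obtain ⟨β, hβ, hmin⟩ := WellFounded.has_min (wellFounded_lt (α := κ.ord.ToType))
      {β | ofBranch y β ∈ U} (hU.meets y)
    have hcard : #(a '' {g | g.IsPrefix (ofBranch y β)}) < κ := by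
      rw [setOf_isPrefix_ofBranch, Set.image_image]
      refine mk_image_le.trans_lt ((mk_le_mk_of_subset fun γ hγ => ?_).trans_lt
        (mk_Iio_lt_of_toType_ord (Order.succ β)))
      exact Order.lt_succ_of_le (Set.mem_Iic.1 hγ)
    obtain ⟨m, hm⟩ := hX.kappaComplete.exists_isGLB _ hcard
    have hmx : m x = true := (hX.apply_isGLB hcard hm x).2 (by
      rw [setOf_isPrefix_ofBranch, Set.image_image]
      rintro _ ⟨γ, -, rfl⟩
      exact hbranch γ)
    have hmc : m ≤ c := hc ⟨ofBranch y β, ⟨hβ, fun g hg hpre => by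
      obtain ⟨γ, hγ, rfl⟩ := isPrefix_ofBranch_iff.1 hpre
      rw [hγ.antisymm (not_lt.1 (hmin γ hg))]⟩, hm⟩
    exact hmx.ge.trans (hmc x)

/-- Evaluation at a point of `X`. -/
def IsKappaSpace.evalAt (hX : IsKappaSpace κ X) (x : X) : KappaHom κ (X →Co Bool) Bool where
  toFun g := g x
  map_isLUB s a hs ha := (Bool.isLUB_image_decide s (fun g : X →Co Bool => g x) (a x)).2
    (hX.apply_isLUB hs ha x)
  map_isGLB s a hs ha := (Bool.isGLB_image_decide s (fun g : X →Co Bool => g x) (a x)).2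
    (hX.apply_isGLB hs ha x)

namespace IsKappaPriestley

/-- If a homomorphism `v` differs from evaluation at every point of a closed set `C`, then by
`κ`-compactness this is witnessed by a single pair: some difference of two clopen upsets that `v`
contains is disjoint from `C`. -/
theorem exists_separating_pair (hX : IsKappaPriestley κ X)
    (v : KappaHom κ (X →Co Bool) Bool) {C : Set X} (hC : IsClosed C)
    (hCv : ∀ y ∈ C, ∃ g : X →Co Bool, g y ≠ v g) :
    ∃ G H : X →Co Bool, v G = true ∧ v H = false ∧ ∀ y ∈ C, G y = true → H y = true := by
  obtain ⟨s, hs, hcov⟩ := hX.kappaCompact.exists_small_subcover hC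
    (fun g : X →Co Bool => {y | g y ≠ v g})
    (fun g => (isOpen_discrete {v g}ᶜ).preimage
      (ContinuousOrderHomClass.toContinuousMapClass.map_continuous g))
    fun y hy => Set.mem_iUnion.2 (hCv y hy)
  have h1 : #{g ∈ s | v g = true} < κ := (mk_le_mk_of_subset (Set.sep_subset _ _)).trans_lt hs
  have h0 : #{g ∈ s | v g = false} < κ := (mk_le_mk_of_subset (Set.sep_subset _ _)).trans_lt hs
  obtain ⟨G, hG⟩ := hX.kappaSpace.kappaComplete.exists_isGLB _ h1
  obtain ⟨H, hH⟩ := hX.kappaSpace.kappaComplete.exists_isLUB _ h0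
  refine ⟨G, H, (v.apply_isGLB h1 hG).2 fun g hg => hg.2, Bool.eq_false_iff.2 fun h => ?_,
    fun y hy hGy => ?_⟩
  · obtain ⟨g, hg, hvg⟩ := (v.apply_isLUB h0 hH).1 h
    exact absurd hvg (Bool.eq_false_iff.1 hg.2)
  · obtain ⟨g, hg, hgy⟩ := Set.mem_iUnion₂.1 (hcov hy)
    replace hgy : g y ≠ v g := hgy
    have hGy' := (hX.kappaSpace.apply_isGLB h1 hG y).1 hGy
    refine (hX.kappaSpace.apply_isLUB h0 hH y).2 ⟨g, ?_⟩
    cases hvg : v g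
    · rw [hvg] at hgy
      exact ⟨⟨hg, hvg⟩, by simpa using hgy⟩
    · exact absurd ((hGy' g ⟨hg, hvg⟩).trans hvg.symm) hgy

theorem exists_apply_of_not_le (hX : IsKappaPriestley κ X) {x y : X} (hxy : ¬ x ≤ y) :
    ∃ g : X →Co Bool, g x = true ∧ g y = false := by
  obtain ⟨U, hU, hU', hx, hy⟩ := hX.priestley.priestley hxy
  exact ⟨.ofClopen U hU hU', (ContinuousOrderHom.ofClopen_apply U hU hU' x).2 hx,
    Bool.eq_false_iff.2 fun h => hy ((ContinuousOrderHom.ofClopen_apply U hU hU' y).1 h)⟩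

theorem exists_evalIso (hX : IsKappaPriestley κ X) (hκ : ℵ₀ ≤ κ) :
    ∃ ψ : X ≃o KappaHom κ (X →Co Bool) Bool, IsHomeomorph ψ ∧ ∀ x g, ψ x g = g x := by
  have hle : ∀ x y, hX.kappaSpace.evalAt x ≤ hX.kappaSpace.evalAt y ↔ x ≤ y := fun x y => by
    refine ⟨fun h => ?_, fun h g => g.monotone' h⟩
    by_contra hn
    obtain ⟨g, hgx, hgy⟩ := hX.exists_apply_of_not_le hn
    have : g x ≤ g y := h g
    rw [hgx, hgy] at this
    exact absurd this (by decide)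
  have hsurj : Function.Surjective hX.kappaSpace.evalAt := fun v => by
    by_contra! hv
    obtain ⟨G, H, hG, hH, hGH⟩ := hX.exists_separating_pair v isClosed_univ fun y _ => by
      by_contra! h
      exact hv y (DFunLike.ext _ _ h)
    have hle : G ≤ H := fun y => by
      cases hy : G y
      · exact bot_le
      · exact (hGH y trivial hy).ge
    have := v.mono hκ hle
    rw [hG, hH] at this
    exact absurd this (by decide)
  let ψ := RelIso.ofSurjective (OrderEmbedding.ofMapLEIff hX.kappaSpace.evalAt hle) hsurj
  refine ⟨ψ, ⟨?_, fun U hU => ?_, ψ.bijective⟩, fun _ _ => rfl⟩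
  · rw [continuous_induced_rng, continuous_pi_iff]
    exact fun g => ContinuousOrderHomClass.toContinuousMapClass.map_continuous g
  · rw [isOpen_iff_mem_nhds]
    rintro _ ⟨x, hx, rfl⟩
    obtain ⟨G, H, hG, hH, hGH⟩ := hX.exists_separating_pair (ψ x) hU.isClosed_compl
      fun y hy => by
        by_contra! h
        have : ψ y = ψ x := DFunLike.ext _ _ h
        exact hy (ψ.injective this ▸ hx)
    refine Filter.mem_of_superset
      ((KappaHom.isClopen_between (κ := κ) (G, H)).2.mem_nhds ⟨hG, hH⟩) fun v hv => ?_
    obtain ⟨y, rfl⟩ := hsurj v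
    refine ⟨y, ?_, rfl⟩
    by_contra hy
    exact absurd (hGH y hy hv.1) (Bool.eq_false_iff.1 hv.2)

end IsKappaPriestley

end ClopenUpsets

/-! ### The duality -/

section Duality

variable {κ : Cardinal.{u}}

/-- An order isomorphism, as a homomorphism of `κ`-complete lattices. -/
def KappaHom.ofOrderIso (κ : Cardinal.{u}) {L M : Type u} [PartialOrder L] [PartialOrder M]
    (e : L ≃o M) : KappaHom κ L M where
  toFun := e
  map_isLUB _ _ _ h := e.isLUB_image'.2 h
  map_isGLB _ _ _ h := e.isGLB_image'.2 h

/-- An order isomorphism, as an isomorphism of `κ`-complete lattices. -/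
def KappaLat.isoOfOrderIso {L M : KappaLat κ} (e : L ≃o M) : L ≅ M where
  hom := KappaHom.ofOrderIso κ e
  inv := KappaHom.ofOrderIso κ e.symm
  hom_inv_id := KappaHom.ext (funext e.symm_apply_apply)
  inv_hom_id := KappaHom.ext (funext e.apply_symm_apply)

/-- An order isomorphism that is a homeomorphism, as an isomorphism of ordered spaces. -/
def OrdTop.isoOfOrderIso {X Y : OrdTop.{u}} (e : X ≃o Y) (he : IsHomeomorph e) : X ≅ Y where
  hom := (⟨⟨e, e.monotone⟩, he.continuous⟩ : X →Co Y)
  inv := (⟨⟨e.symm, e.symm.monotone⟩, by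
    refine continuous_def.2 fun U hU => ?_
    exact (congrArg IsOpen (e.toEquiv.image_eq_preimage_symm U)).mp (he.isOpenMap U hU)⟩ : Y →Co X)
  hom_inv_id := DFunLike.ext (F := X →Co X) _ _ e.symm_apply_apply
  inv_hom_id := DFunLike.ext (F := Y →Co Y) _ _ e.apply_symm_apply

end Duality

theorem mainTheorem10 (κ : Cardinal.{u}) (hκ : IsWeaklyCompact κ) :
    ∃ (hL : ∀ L : KappaDistLat κ, isKappaPriestleySp κ ((homTwoLat κ).obj (Opposite.op L.obj)))
      (hX : ∀ X : KappaPriestley κ, isKappaDistLat κ ((homTwoSpace κ).obj (Opposite.op X)))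
      (e : (KappaDistLat κ)ᵒᵖ ≌ KappaPriestley κ),
      e.functor = specFunctor κ hL ∧
      e.inverse = (clopenUpsetFunctor κ hX).rightOp ∧
      (∀ L : KappaDistLat κ, ∃ φ : L.obj ≃o (KappaHom κ L.obj Bool →Co Bool),
        ∀ a h, φ a h = h a) ∧
      (∀ X : KappaPriestley κ, ∃ ψ : X.obj ≃o KappaHom κ (X.obj →Co Bool) Bool,
        IsHomeomorph ψ ∧ ∀ x g, ψ x g = g x) := by
  have hL : ∀ L : KappaDistLat κ, isKappaPriestleySp κ ((homTwoLat κ).obj (Opposite.op L.obj)) :=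
    fun L => ⟨KappaHom.isKappaPriestley hκ L.property.2, KappaHom.weightLE hκ.1 L.property.2⟩
  have hX : ∀ X : KappaPriestley κ, isKappaDistLat κ ((homTwoSpace κ).obj (Opposite.op X)) :=
    fun X => ⟨X.property.1.kappaSpace.isKappaDistributive hκ.1,
      X.property.1.kappaCompact.mk_continuousOrderHom_le hκ X.property.2⟩
  have hφ : ∀ L : KappaDistLat κ, ∃ φ : L.obj ≃o (KappaHom κ L.obj Bool →Co Bool),
      ∀ a h, φ a h = h a := fun L => L.property.1.exists_evalIso hκ L.property.2
  have hψ : ∀ X : KappaPriestley κ, ∃ ψ : X.obj ≃o KappaHom κ (X.obj →Co Bool) Bool,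
      IsHomeomorph ψ ∧ ∀ x g, ψ x g = g x := fun X => X.property.1.exists_evalIso hκ.1
  choose φ hφe using id hφ
  choose ψ hψh hψe using id hψ
  let F := specFunctor κ hL
  let G := (clopenUpsetFunctor κ hX).rightOp
  let η : F ⋙ G ≅ 𝟭 (KappaDistLat κ)ᵒᵖ := NatIso.ofComponents
    (fun L => ((isKappaDistLat κ).isoMk (X := L.unop) (Y := (G.obj (F.obj L)).unop)
      (KappaLat.isoOfOrderIso (φ L.unop))).op)
    (fun {L M} f => by
      refine Quiver.Hom.unop_inj (ObjectProperty.hom_ext _ (KappaHom.ext (funext fun a => ?_)))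
      refine DFunLike.ext (F := KappaHom κ L.unop.obj Bool →Co Bool) _ _ fun h => ?_
      exact (hφe M.unop a _).trans (hφe L.unop _ h).symm)
  let ε : 𝟭 (KappaPriestley κ) ≅ G ⋙ F := NatIso.ofComponents
    (fun X => (isKappaPriestleySp κ).isoMk (X := X) (Y := F.obj (G.obj X))
      (OrdTop.isoOfOrderIso (ψ X) (hψh X)))
    (fun {X Y} f => by
      refine ObjectProperty.hom_ext _ ?_
      refine DFunLike.ext (F := X.obj →Co KappaHom κ (Y.obj →Co Bool) Bool) _ _ fun x => ?_
      refine KappaHom.ext (funext fun g => ?_)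
      exact (hψe Y _ g).trans (hψe X x (ContinuousOrderHom.comp g f.hom)).symm)
  exact ⟨hL, hX, CategoryTheory.Equivalence.mk F G η.symm ε.symm, rfl, rfl, hφ, hψ⟩
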